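/- Let $\lambda>-1/2$, $\lambda\neq 0$, and $\rho>1$. Let $C_n^\lambda$ be the Gegenbauer polynomials, defined by $C_0^\lambda(x)=1$, $C_1^\lambda(x)=2\lambda x$ and $nC_n^\lambda(x)=2(n+\lambda-1)\,x\,C_{n-1}^\lambda(x)-(n+2\lambda-2)\,C_{n-2}^\lambda(x)$ for $n\ge 2$. Let $\mathcal E_\rho=\{\tfrac12(w+w^{-1}) : w\in\mathbb C,\ |w|=\rho\}$ be the Bernstein ellipse, which has foci $\pm1$. For every $n\ge 0$ the polynomial $C_{n+1}^\lambda$ has exactly $n+1$ distinct real zeros $x_0,\dots,x_n$ (the Gegenbauer–Gauss points). For a function $u$ that is analytic on and within $\mathcal E_\rho$, let $I_nu$ be the polynomial of degree at most $n$ with $(I_nu)(x_j)=u(x_j)$ for $0\le j\le n$, and let $M_\rho=\max_{z\in\mathcal E_\rho}|u(z)|$. There is a sequence of positive numbers $c_n$, depending only on $n$, $\lambda$ and $\rho$ (not on $u$), with $c_n\to1$ as $n\to\infty$, such that for every $u$ analytic on and within $\mathcal E_\rho$ and every $n\ge1$, $$\max_{0\le j\le n}\big|(u-I_nu)'(x_j)\big|\le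 \Lambda_n(\rho,\lambda)\,\frac{n^{\lambda+2}}{\rho^n},$$ where $$\Lambda_n(\rho,\lambda)=\frac{2\,c_n\,\Gamma(\lambda+1)\,M_\rho\,\sqrt{\rho^2+\rho^{-2}}}{\Gamma(2\lambda+2)\,(\rho-1)^2}\cdot\begin{cases}(1+\rho^{-2})^{\lambda}, & \lambda>0,\\ (1-\rho^{-2})^{\lambda}, & \lambda<0.\end{cases}$$ -/

import Mathlib

open Polynomial Filter Topology

noncomputable section

/-- The Gegenbauer (ultraspherical) polynomial `C_n^λ`, in Szegő's normalization, defined by the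
three-term recurrence
`n C_n^λ = 2 (n + λ - 1) X C_{n-1}^λ - (n + 2 λ - 2) C_{n-2}^λ`, `C_0^λ = 1`, `C_1^λ = 2 λ X`. -/
def gegenbauer (lam : ℝ) : ℕ → ℝ[X]
  | 0 => 1
  | 1 => C (2 * lam) * X
  | n + 2 =>
      C (1 / ((n : ℝ) + 2)) *
        (C (2 * ((n : ℝ) + 1 + lam)) * X * gegenbauer lam (n + 1)
          - C ((n : ℝ) + 2 * lam) * gegenbauer lam n)

/-- The Gegenbauer–Gauss points of index `n`: the zeros of `C_{n+1}^λ`. -/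
def gegenbauerGauss (lam : ℝ) (n : ℕ) : Finset ℝ :=
  (gegenbauer lam (n + 1)).roots.toFinset

/-- The interpolation polynomial `I_n u` of `u` at the Gegenbauer–Gauss points. -/
def gegenbauerInterp (lam : ℝ) (n : ℕ) (u : ℂ → ℂ) : ℂ[X] :=
  Lagrange.interpolate (gegenbauerGauss lam n) (fun x : ℝ => (x : ℂ)) (fun x : ℝ => u (x : ℂ))

/-- The Bernstein ellipse `E_ρ`, the image of the circle `|w| = ρ` under `w ↦ (w + w⁻¹) / 2`. -/
def bernsteinEllipse (rho : ℝ) : Set ℂ :=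
  {z : ℂ | ∃ w : ℂ, ‖w‖ = rho ∧ z = (w + w⁻¹) / 2}

/-- The closed region consisting of the points on and within `E_ρ`, which is the ellipse with
centre `0` and semi-axes `(ρ + ρ⁻¹) / 2` (real direction) and `(ρ - ρ⁻¹) / 2`. -/
def bernsteinRegion (rho : ℝ) : Set ℂ :=
  {z : ℂ | (z.re / ((rho + rho⁻¹) / 2)) ^ 2 + (z.im / ((rho - rho⁻¹) / 2)) ^ 2 ≤ 1}

/-- `M_ρ = max_{z ∈ E_ρ} |u z|`. -/
def ellipseMax (rho : ℝ) (u : ℂ → ℂ) : ℝ :=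
  sSup ((fun z : ℂ => ‖u z‖) '' bernsteinEllipse rho)

/-- The constant `Λ(ρ, λ)` of the estimate, with its factor `c` and with `M = M_ρ` displayed. -/
def spectralDiffConst (c M rho lam : ℝ) : ℝ :=
  2 * c * Real.Gamma (lam + 1) * M * Real.sqrt (rho ^ 2 + (rho ^ 2)⁻¹)
      / (Real.Gamma (2 * lam + 2) * (rho - 1) ^ 2)
    * (if 0 < lam then (1 + (rho ^ 2)⁻¹) ^ lam else (1 - (rho ^ 2)⁻¹) ^ lam)

end

/-! Write p = C_{n+1}^λ. The error u - I_n u vanishes at the nodes, so it equals q times the product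
of the (z - x_j), with q analytic on the elliptic region. At a node y its derivative is p'(y) q(y) /
(leading coefficient of p), and Hermite's contour formula expresses q(y) through the integral of
u(z) / (p(z)(z - y)) over the ellipse (`ellipseIntegral_div_prod`, `norm_deriv_sub_interpolate_le`).

Four estimates then suffice. Since p' = 2λ C_n^{λ+1} with λ + 1 > 0, |p'| on [-1,1] is at most 2|λ|
C_n^{λ+1}(1). The distance from the ellipse to [-1,1] is at least (ρ-1)²/(2ρ). The length of the
ellipse is at most π √(ρ² + ρ⁻²), by Cauchy–Schwarz. Finally, with z = (v + v⁻¹)/2 and |v| = 1/ρ,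
v^n C_n^λ(z) is a convolution of binomial coefficients; divided by (λ)_n / n! it converges uniformly
to (1 - v²)^{-λ}, which gives the sharp lower bound `exists_lower_bound_gegenbauer`. Gauss's limit
for Γ turns the remaining ratio of coefficients into n^{λ+2} times Gamma values, up to c_n → 1.

Using the inner circle |v| = 1/ρ puts every integrand inside the unit disc, where Cauchy's theorem
on discs and annuli is enough. The ellipse is then traversed clockwise, hence the minus signs. -/

/-- The coefficient `(s)_k / k!` of `t ^ k` in the expansion of `(1 - t) ^ (-s)`. -/
noncomputable def risingCoeff (s : ℝ) (k : ℕ) : ℝ :=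
  ∏ j ∈ Finset.range k, (s + j) / ((j : ℝ) + 1)

@[simp] lemma risingCoeff_zero (s : ℝ) : risingCoeff s 0 = 1 := by simp [risingCoeff]

lemma risingCoeff_succ (s : ℝ) (k : ℕ) :
    ((k : ℝ) + 1) * risingCoeff s (k + 1) = (s + k) * risingCoeff s k := by
  have : (k : ℝ) + 1 ≠ 0 := by positivity
  rw [risingCoeff, Finset.prod_range_succ, ← risingCoeff]
  field_simp

lemma risingCoeff_succ' (s : ℝ) (k : ℕ) :
    risingCoeff s (k + 1) = risingCoeff s k * ((s + k) / ((k : ℝ) + 1)) := by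
  rw [risingCoeff, Finset.prod_range_succ, ← risingCoeff]

lemma risingCoeff_pos {s : ℝ} (hs : 0 < s) (k : ℕ) : 0 < risingCoeff s k := by
  unfold risingCoeff
  exact Finset.prod_pos fun j _ => by positivity

/-! ### Algebraic identities for Gegenbauer polynomials. -/

lemma gegenbauer_succ_succ (lam : ℝ) (n : ℕ) :
    C ((n : ℝ) + 2) * gegenbauer lam (n + 2) =
      C (2 * ((n : ℝ) + 1 + lam)) * X * gegenbauer lam (n + 1)
        - C ((n : ℝ) + 2 * lam) * gegenbauer lam n := by
  have h : (n : ℝ) + 2 ≠ 0 := by positivity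
  rw [gegenbauer, ← mul_assoc, ← C_mul, mul_one_div_cancel h, C_1, one_mul]

lemma aeval_gegenbauer_succ_succ {A : Type*} [CommRing A] [Algebra ℝ A] (lam : ℝ) (n : ℕ) (z : A) :
    algebraMap ℝ A ((n : ℝ) + 2) * aeval z (gegenbauer lam (n + 2)) =
      algebraMap ℝ A (2 * ((n : ℝ) + 1 + lam)) * z * aeval z (gegenbauer lam (n + 1))
        - algebraMap ℝ A ((n : ℝ) + 2 * lam) * aeval z (gegenbauer lam n) := by
  simpa only [map_mul, map_sub, aeval_C, aeval_X] using
    congrArg (aeval z) (gegenbauer_succ_succ lam n)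

lemma eval_gegenbauer_succ_succ (lam : ℝ) (n : ℕ) (x : ℝ) :
    ((n : ℝ) + 2) * (gegenbauer lam (n + 2)).eval x =
      2 * ((n : ℝ) + 1 + lam) * x * (gegenbauer lam (n + 1)).eval x
        - ((n : ℝ) + 2 * lam) * (gegenbauer lam n).eval x := by
  simpa using aeval_gegenbauer_succ_succ lam n x

lemma eval_one_gegenbauer (lam : ℝ) (n : ℕ) :
    (gegenbauer lam n).eval 1 = risingCoeff (2 * lam) n := by
  induction n using Nat.twoStepInduction with
  | zero => simp [gegenbauer]
  | one => simp [gegenbauer, risingCoeff]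
  | more n h0 h1 =>
    have h := eval_gegenbauer_succ_succ lam n 1
    rw [h0, h1] at h
    have e1 := risingCoeff_succ (2 * lam) n
    have e2 := risingCoeff_succ (2 * lam) (n + 1)
    push_cast at e2
    have hn : (n : ℝ) + 2 ≠ 0 := by positivity
    apply mul_left_cancel₀ hn
    linear_combination h - e2 + e1

lemma eval_neg_gegenbauer (lam : ℝ) (n : ℕ) (x : ℝ) :
    (gegenbauer lam n).eval (-x) = (-1) ^ n * (gegenbauer lam n).eval x := by
  induction n using Nat.twoStepInduction with
  | zero => simp [gegenbauer]
  | one => simp [gegenbauer]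
  | more n h0 h1 =>
    have h := eval_gegenbauer_succ_succ lam n (-x)
    have h' := eval_gegenbauer_succ_succ lam n x
    rw [h0, h1] at h
    have hn : (n : ℝ) + 2 ≠ 0 := by positivity
    apply mul_left_cancel₀ hn
    linear_combination h - (-1) ^ (n + 2) * h'

/-- In generating functions: (1 - 2xt + t²)^{-λ} is (1 - 2xt + t²) times (1 - 2xt + t²)^{-(λ+1)}. -/
lemma gegenbauer_contiguous (lam : ℝ) (n : ℕ) :
    gegenbauer lam (n + 2) = gegenbauer (lam + 1) (n + 2)
      - 2 * X * gegenbauer (lam + 1) (n + 1) + gegenbauer (lam + 1) n := by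
  have key : ∀ n : ℕ, (C ((n : ℝ) + 2) : ℝ[X]) ≠ 0 := fun n => by
    rw [Ne, C_eq_zero]; positivity
  induction n using Nat.twoStepInduction with
  | zero =>
    have h2 := gegenbauer_succ_succ lam 0
    have g2 := gegenbauer_succ_succ (lam + 1) 0
    apply mul_left_cancel₀ (key 0)
    simp only [gegenbauer.eq_1, gegenbauer.eq_2, map_add, map_mul, map_ofNat, map_natCast, map_one,
      zero_add] at *
    push_cast at *
    linear_combination h2 - g2
  | one =>
    have h2 := gegenbauer_succ_succ lam 0
    have g2 := gegenbauer_succ_succ (lam + 1) 0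
    have g3 := gegenbauer_succ_succ (lam + 1) 1
    apply mul_left_cancel₀ (mul_ne_zero (key 0) (key 1))
    have h3 := gegenbauer_succ_succ lam 1
    simp only [gegenbauer.eq_1, gegenbauer.eq_2, map_add, map_mul, map_ofNat, map_natCast, map_one,
      zero_add, Nat.reduceAdd] at *
    push_cast at *
    generalize gegenbauer lam 2 = c2 at *
    generalize gegenbauer lam 3 = c3 at *
    generalize gegenbauer (lam+1) 2 = d2 at *
    generalize gegenbauer (lam+1) 3 = d3 at *
    linear_combination 2 * h3 + 2 * (2 + C lam) * X * h2 - 2 * g3 + (6 * X - 2 * (2 + (C lam + 1)) * X) * g2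
  | more n h0 h1 =>
    have c4 := gegenbauer_succ_succ lam (n + 2)
    have g2 := gegenbauer_succ_succ (lam + 1) n
    have g3 := gegenbauer_succ_succ (lam + 1) (n + 1)
    have g4 := gegenbauer_succ_succ (lam + 1) (n + 2)
    apply mul_left_cancel₀ (key (n + 2))
    simp only [map_add, map_mul, map_ofNat, map_natCast, map_one, add_assoc, Nat.reduceAdd] at *
    rw [c4, h0, h1]
    push_cast at *
    linear_combination -g4 + 2 * X * g3 - g2

lemma derivative_gegenbauer_succ (lam : ℝ) (n : ℕ) :
    derivative (gegenbauer lam (n + 1)) = C (2 * lam) * gegenbauer (lam + 1) n := by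
  induction n using Nat.twoStepInduction with
  | zero => simp [gegenbauer]
  | one =>
    have key : (C ((0 : ℕ) + (2 : ℝ)) : ℝ[X]) ≠ 0 := by rw [Ne, C_eq_zero]; simp
    apply mul_left_cancel₀ key
    have h := congrArg derivative (gegenbauer_succ_succ lam 0)
    simp only [derivative_mul, derivative_sub, derivative_C, gegenbauer.eq_1, gegenbauer.eq_2,
      zero_add] at h
    simp only [derivative_X, gegenbauer.eq_1,
      gegenbauer.eq_2, map_add, map_mul, map_ofNat, map_natCast, map_one,
      Nat.reduceAdd, derivative_one] at *
    push_cast at *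
    linear_combination h
  | more n h0 h1 =>
    have key : (C (((n + 1 : ℕ) : ℝ) + (2 : ℝ)) : ℝ[X]) ≠ 0 := by
      rw [Ne, C_eq_zero]; positivity
    apply mul_left_cancel₀ key
    -- Differentiating the recurrence leaves one undifferentiated term `gegenbauer lam (n + 2)`; the
    -- contiguous relation moves it to parameter λ + 1.
    have h := congrArg derivative (gegenbauer_succ_succ lam (n + 1))
    have hc := gegenbauer_contiguous lam n
    have g2 := gegenbauer_succ_succ (lam + 1) n
    rw [derivative_mul, derivative_sub, derivative_mul, derivative_mul, derivative_mul] at h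
    simp only [derivative_C, zero_mul, zero_add] at h
    simp only [derivative_X, map_add, map_mul, map_ofNat, map_natCast, map_one,
      mul_one, add_assoc, Nat.reduceAdd] at *
    rw [h0, h1, hc] at h
    push_cast at *
    linear_combination h + (2 - 2 * C lam) * g2

/-! ### Expansion under the Joukowski map. -/

lemma sum_risingCoeff_recurrence (s : ℝ) (q : ℂ) (n : ℕ) :
    ((n : ℂ) + 2) * ∑ p ∈ Finset.HasAntidiagonal.antidiagonal (n + 2),
        (risingCoeff s p.1 : ℂ) * q ^ p.1 * risingCoeff s p.2 =
      ((n : ℂ) + 1 + s) * (1 + q) * ∑ p ∈ Finset.HasAntidiagonal.antidiagonal (n + 1),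
        (risingCoeff s p.1 : ℂ) * q ^ p.1 * risingCoeff s p.2
      - ((n : ℂ) + 2 * s) * q * ∑ p ∈ Finset.HasAntidiagonal.antidiagonal n,
        (risingCoeff s p.1 : ℂ) * q ^ p.1 * risingCoeff s p.2 := by
  -- A and B are the series of (1 - qt)^{-s} and (1 - t)^{-s}, each encoded by its first-order
  -- differential equation.
  set A : PowerSeries ℂ := PowerSeries.mk fun k => (risingCoeff s k : ℂ) * q ^ k with hA
  set B : PowerSeries ℂ := PowerSeries.mk fun k => (risingCoeff s k : ℂ) with hB
  have hs : ∀ k : ℕ, ((k : ℂ) + 1) * (risingCoeff s (k + 1) : ℂ) = (s + k) * risingCoeff s k := by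
    intro k
    exact_mod_cast congrArg (fun x : ℝ => (x : ℂ)) (risingCoeff_succ s k)
  have dA : PowerSeries.derivative ℂ A * (1 - PowerSeries.C q * PowerSeries.X)
      = PowerSeries.C (s * q) * A := by
    ext k
    rw [mul_sub, mul_one, map_sub, ← mul_assoc, mul_right_comm, PowerSeries.coeff_mul_C]
    rw [PowerSeries.coeff_derivative]
    cases k with
    | zero =>
      have := hs 0
      simp only [Nat.cast_zero, zero_add, one_mul, add_zero, risingCoeff_zero, Complex.ofReal_one,
        mul_one] at this
      simp [hA, this]
    | succ k =>
      rw [PowerSeries.coeff_succ_mul_X, PowerSeries.coeff_derivative]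
      simp only [hA, PowerSeries.coeff_mk, PowerSeries.coeff_C_mul]
      have := hs (k + 1)
      push_cast at this ⊢
      linear_combination q ^ (k + 2) * this
  have dB : PowerSeries.derivative ℂ B * (1 - PowerSeries.X) = PowerSeries.C (s : ℂ) * B := by
    ext k
    rw [mul_sub, mul_one, map_sub, PowerSeries.coeff_derivative]
    cases k with
    | zero =>
      have := hs 0
      simp [hB] at this ⊢
      rw [this]
    | succ k =>
      rw [PowerSeries.coeff_succ_mul_X, PowerSeries.coeff_derivative]
      simp only [hB, PowerSeries.coeff_mk, PowerSeries.coeff_C_mul]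
      have := hs (k + 1)
      push_cast at this ⊢
      linear_combination this
  have hS : ∀ m : ℕ, ∑ p ∈ Finset.HasAntidiagonal.antidiagonal m,
      (risingCoeff s p.1 : ℂ) * q ^ p.1 * risingCoeff s p.2 = PowerSeries.coeff m (A * B) := by
    intro m
    simp [PowerSeries.coeff_mul, hA, hB]
  simp only [hS]
  set F := A * B with hF
  -- The logarithmic derivatives add up to (1 - qt)(1 - t) F' = s((1 + q) - 2qt) F; its coefficient
  -- of t^{n+1} is the recurrence.
  have dF : PowerSeries.derivative ℂ F
      - PowerSeries.C (1 + q) * (PowerSeries.derivative ℂ F * PowerSeries.X)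
      + PowerSeries.C q * (PowerSeries.derivative ℂ F * PowerSeries.X * PowerSeries.X)
      = PowerSeries.C (s * (1 + q)) * F - PowerSeries.C (2 * s * q) * (F * PowerSeries.X) := by
    rw [hF, Derivation.leibniz]
    simp only [smul_eq_mul]
    simp only [map_mul, map_add, map_one, map_ofNat] at *
    linear_combination (B * (1 - PowerSeries.X)) * dA
      + (A * (1 - PowerSeries.C q * PowerSeries.X)) * dB
  generalize hb : 1 + q = b at dF ⊢
  have := congrArg (PowerSeries.coeff (n + 1)) dF
  simp only [map_add, map_sub, PowerSeries.coeff_C_mul, PowerSeries.coeff_succ_mul_X,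
    PowerSeries.coeff_derivative] at this
  cases n with
  | zero =>
    simp only [PowerSeries.coeff_zero_mul_X] at this
    push_cast at *
    simp only [zero_add] at *
    linear_combination this
  | succ n =>
    simp only [PowerSeries.coeff_succ_mul_X, PowerSeries.coeff_derivative] at this
    push_cast at *
    simp only [add_assoc, Nat.reduceAdd] at *
    linear_combination this

/-- The expansion of `C_n^λ` under the Joukowski map. -/
lemma pow_mul_aeval_gegenbauer (lam : ℝ) (n : ℕ) {v : ℂ} (hv : v ≠ 0) :
    v ^ n * aeval ((v + v⁻¹) / 2) (gegenbauer lam n) =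
      ∑ p ∈ Finset.HasAntidiagonal.antidiagonal n,
        (risingCoeff lam p.1 : ℂ) * (v ^ 2) ^ p.1 * risingCoeff lam p.2 := by
  induction n using Nat.twoStepInduction with
  | zero => simp [gegenbauer]
  | one =>
    simp [gegenbauer, risingCoeff, Finset.HasAntidiagonal.antidiagonal, Finset.sum]
    field_simp
    ring
  | more n h0 h1 =>
    have h := aeval_gegenbauer_succ_succ lam n ((v + v⁻¹) / 2)
    have hr := sum_risingCoeff_recurrence lam (v ^ 2) n
    rw [← h0, ← h1] at hr
    have hn : (n : ℂ) + 2 ≠ 0 := by exact_mod_cast (by positivity : (n + 2 : ℕ) ≠ 0)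
    apply mul_left_cancel₀ hn
    rw [hr]
    have hvv : v * v⁻¹ = 1 := mul_inv_cancel₀ hv
    simp only [Complex.coe_algebraMap] at h
    push_cast at h
    linear_combination v ^ (n + 2) * h
      + v ^ (n + 1) * ((n : ℂ) + 1 + lam) * aeval ((v + v⁻¹) / 2) (gegenbauer lam (n + 1)) * hvv

lemma sum_risingCoeff_antidiagonal (lam : ℝ) (n : ℕ) :
    ∑ p ∈ Finset.HasAntidiagonal.antidiagonal n, risingCoeff lam p.1 * risingCoeff lam p.2
      = (gegenbauer lam n).eval 1 := by
  have h := pow_mul_aeval_gegenbauer lam n (one_ne_zero (α := ℂ))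
  have e : ((1 : ℂ) + 1⁻¹) / 2 = ((1 : ℝ) : ℂ) := by norm_num
  rw [e, show ((1 : ℝ) : ℂ) = algebraMap ℝ ℂ 1 from rfl, aeval_algebraMap_apply] at h
  simp only [one_pow, one_mul, mul_one, Complex.coe_algebraMap, coe_aeval_eq_eval] at h
  exact_mod_cast h.symm

lemma exists_norm_eq_one_joukowski {x : ℝ} (hx : |x| ≤ 1) :
    ∃ v : ℂ, ‖v‖ = 1 ∧ (x : ℂ) = (v + v⁻¹) / 2 := by
  refine ⟨Complex.exp (Real.arccos x * Complex.I), Complex.norm_exp_ofReal_mul_I _, ?_⟩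
  rw [← Complex.exp_neg, ← neg_mul, ← Complex.cos, ← Complex.ofReal_cos,
    Real.cos_arccos (abs_le.mp hx).1 (abs_le.mp hx).2]

/-- For μ > 0 all coefficients of the Joukowski expansion are positive, so on |v| = 1 the modulus is
largest at v = 1. -/
lemma abs_eval_gegenbauer_le {mu : ℝ} (hmu : 0 < mu) (n : ℕ) {x : ℝ} (hx : |x| ≤ 1) :
    |(gegenbauer mu n).eval x| ≤ risingCoeff (2 * mu) n := by
  obtain ⟨v, hv, hxv⟩ := exists_norm_eq_one_joukowski hx
  have hv0 : v ≠ 0 := by rintro rfl; simp at hv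
  have h := pow_mul_aeval_gegenbauer mu n hv0
  rw [← hxv, show (x : ℂ) = algebraMap ℝ ℂ x from rfl, aeval_algebraMap_apply] at h
  have h2 := congrArg norm h
  rw [norm_mul, norm_pow, hv, one_pow, one_mul, coe_aeval_eq_eval, Complex.coe_algebraMap,
    Complex.norm_real, Real.norm_eq_abs] at h2
  rw [h2, ← eval_one_gegenbauer, ← sum_risingCoeff_antidiagonal]
  refine (norm_sum_le _ _).trans (Finset.sum_le_sum fun p _ => ?_)
  simp [hv, abs_of_pos (risingCoeff_pos hmu _)]

/-! ### Zeros of the Gegenbauer polynomials: real, simple, inside (-1, 1). -/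

section Zeros

variable {lam : ℝ}

lemma risingCoeff_ne_zero (hlam : -(1 / 2 : ℝ) < lam) (hlam0 : lam ≠ 0) (n : ℕ) :
    risingCoeff lam n ≠ 0 := by
  refine Finset.prod_ne_zero_iff.mpr fun j _ => div_ne_zero ?_ (by positivity)
  rcases j with _ | j
  · simpa using hlam0
  · push_cast
    have : (0 : ℝ) ≤ j := by positivity
    linarith

/-- For λ < 0 the single negative factor 2λ fixes the sign; the extra factor λ treats both signs at
once. -/
lemma mul_risingCoeff_two_mul_pos (hlam : -(1 / 2 : ℝ) < lam) (hlam0 : lam ≠ 0) (n : ℕ) :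
    0 < lam * risingCoeff (2 * lam) (n + 1) := by
  induction n with
  | zero =>
    have := pow_two_pos_of_ne_zero hlam0
    simp [risingCoeff]
    nlinarith
  | succ n ih =>
    rw [risingCoeff_succ', ← mul_assoc]
    refine mul_pos ih (div_pos ?_ (by positivity))
    push_cast
    have : (0 : ℝ) ≤ n := by positivity
    linarith

lemma natDegree_gegenbauer_le_and_coeff (n : ℕ) :
    (gegenbauer lam n).natDegree ≤ n ∧
      (gegenbauer lam n).coeff n = 2 ^ n * risingCoeff lam n := by
  induction n using Nat.twoStepInduction with
  | zero => simp [gegenbauer]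
  | one =>
    refine ⟨(natDegree_C_mul_le _ _).trans natDegree_X_le, ?_⟩
    simp [gegenbauer, risingCoeff]
  | more n h0 h1 =>
    have hd : (C (2 * ((n : ℝ) + 1 + lam)) * X * gegenbauer lam (n + 1)
        - C ((n : ℝ) + 2 * lam) * gegenbauer lam n).natDegree ≤ n + 2 := by
      refine (natDegree_sub_le _ _).trans (max_le ?_ ?_)
      · refine natDegree_mul_le.trans ?_
        have := (natDegree_C_mul_le (2 * ((n : ℝ) + 1 + lam)) X).trans natDegree_X_le
        omega
      · exact (natDegree_C_mul_le _ _).trans (by omega)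
    refine ⟨?_, ?_⟩
    · rw [gegenbauer]
      exact (natDegree_C_mul_le _ _).trans hd
    · have h := congrArg (fun p => coeff p (n + 2)) (gegenbauer_succ_succ lam n)
      simp only [coeff_C_mul, coeff_sub] at h
      rw [mul_assoc, coeff_C_mul, coeff_X_mul, h1.2,
        coeff_eq_zero_of_natDegree_lt (show (gegenbauer lam n).natDegree < n + 2 by omega)] at h
      have hr := risingCoeff_succ lam (n + 1)
      have hn : (n : ℝ) + 2 ≠ 0 := by positivity
      apply mul_left_cancel₀ hn
      push_cast at hr
      rw [h]
      linear_combination -2 ^ (n + 2) * hr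

lemma natDegree_gegenbauer (hlam : -(1 / 2 : ℝ) < lam) (hlam0 : lam ≠ 0) (n : ℕ) :
    (gegenbauer lam n).natDegree = n := by
  obtain ⟨h1, h2⟩ := natDegree_gegenbauer_le_and_coeff (lam := lam) n
  refine natDegree_eq_of_le_of_coeff_ne_zero h1 ?_
  rw [h2]
  exact mul_ne_zero (by positivity) (risingCoeff_ne_zero hlam hlam0 n)

lemma gegenbauer_ne_zero (hlam : -(1 / 2 : ℝ) < lam) (hlam0 : lam ≠ 0) (n : ℕ) :
    gegenbauer lam n ≠ 0 := by
  rcases n with _ | n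
  · simp [gegenbauer]
  · intro h
    simpa [h] using natDegree_gegenbauer hlam hlam0 (n + 1)

/-- Multiply the recurrence by the conjugate of C_{n+1} and take imaginary parts. The indices start
at (2, 1) because the pair (1, 0) has the sign of λ; its coefficient 2λ repairs this, giving 4λ² Im
z, and all later coefficients n + 2λ are positive. -/
lemma im_aeval_gegenbauer_mul_conj_pos (hlam : -(1 / 2 : ℝ) < lam) (hlam0 : lam ≠ 0)
    {z : ℂ} (hz : 0 < z.im) (n : ℕ) :
    0 < (aeval z (gegenbauer lam (n + 2)) *
      (starRingEnd ℂ) (aeval z (gegenbauer lam (n + 1)))).im := by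
  have hrec : ∀ n : ℕ, ((n : ℝ) + 2) * (aeval z (gegenbauer lam (n + 2)) *
      (starRingEnd ℂ) (aeval z (gegenbauer lam (n + 1)))).im =
      2 * (n + 1 + lam) * z.im * Complex.normSq (aeval z (gegenbauer lam (n + 1)))
      + (n + 2 * lam) * (aeval z (gegenbauer lam (n + 1)) *
      (starRingEnd ℂ) (aeval z (gegenbauer lam n))).im := by
    intro n
    have h := congrArg (fun w => (w * (starRingEnd ℂ) (aeval z (gegenbauer lam (n + 1)))).im)
      (aeval_gegenbauer_succ_succ lam n z)
    simp only [Complex.coe_algebraMap] at h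
    generalize aeval z (gegenbauer lam (n + 2)) = c at *
    generalize aeval z (gegenbauer lam (n + 1)) = b at *
    generalize aeval z (gegenbauer lam n) = a at *
    simp only [Complex.normSq_apply, Complex.mul_im, Complex.mul_re, Complex.sub_re,
      Complex.sub_im, Complex.conj_re, Complex.conj_im, Complex.ofReal_re, Complex.ofReal_im] at *
    linear_combination h
  induction n with
  | zero =>
    have h := hrec 0
    have hp : 0 < lam ^ 2 * z.im := by positivity
    have hq := Complex.normSq_nonneg (aeval z (gegenbauer lam 1))
    have hq' : 0 ≤ (1 + lam) * z.im * Complex.normSq (aeval z (gegenbauer lam 1)) :=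
      mul_nonneg (mul_nonneg (by linarith) hz.le) hq
    have hT : (aeval z (gegenbauer lam 1) * (starRingEnd ℂ) (aeval z (gegenbauer lam 0))).im
        = 2 * lam * z.im := by
      simp [gegenbauer]
    simp only [zero_add, Nat.cast_zero] at h ⊢
    rw [hT] at h
    nlinarith
  | succ n ih =>
    have h := hrec (n + 1)
    have hq := Complex.normSq_nonneg (aeval z (gegenbauer lam (n + 2)))
    have hn : (0 : ℝ) ≤ n := by positivity
    push_cast at h
    refine pos_of_mul_pos_right (a := (n : ℝ) + 1 + 2) ?_ (by positivity)
    rw [h]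
    have hq' := mul_nonneg (mul_nonneg (by linarith : 0 ≤ 2 * ((n : ℝ) + 1 + 1 + lam)) hz.le) hq
    have := mul_pos (by linarith : 0 < (n : ℝ) + 1 + 2 * lam) ih
    linarith

lemma im_eq_zero_of_aeval_gegenbauer_eq_zero (hlam : -(1 / 2 : ℝ) < lam) (hlam0 : lam ≠ 0)
    {n : ℕ} {z : ℂ} (hz : aeval z (gegenbauer lam (n + 1)) = 0) : z.im = 0 := by
  rcases lt_trichotomy z.im 0 with h | h | h
  · have h' : 0 < ((starRingEnd ℂ) z).im := by simpa using h
    have := im_aeval_gegenbauer_mul_conj_pos hlam hlam0 h' n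
    simp [aeval_conj, hz] at this
  · exact h
  · have := im_aeval_gegenbauer_mul_conj_pos hlam hlam0 h n
    simp [hz] at this

/-- Confluent version of the same argument on the real line. A double zero would annihilate the
Wronskian, so zeros are simple. -/
lemma gegenbauer_wronskian_pos (hlam : -(1 / 2 : ℝ) < lam) (hlam0 : lam ≠ 0) (x : ℝ) (n : ℕ) :
    0 < (derivative (gegenbauer lam (n + 2))).eval x * (gegenbauer lam (n + 1)).eval x
      - (gegenbauer lam (n + 2)).eval x * (derivative (gegenbauer lam (n + 1))).eval x := by
  have hrec : ∀ n : ℕ, ((n : ℝ) + 2) *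
      ((derivative (gegenbauer lam (n + 2))).eval x * (gegenbauer lam (n + 1)).eval x
      - (gegenbauer lam (n + 2)).eval x * (derivative (gegenbauer lam (n + 1))).eval x)
      = 2 * (n + 1 + lam) * (gegenbauer lam (n + 1)).eval x ^ 2
      + (n + 2 * lam) *
      ((derivative (gegenbauer lam (n + 1))).eval x * (gegenbauer lam n).eval x
      - (gegenbauer lam (n + 1)).eval x * (derivative (gegenbauer lam n)).eval x) := by
    intro n
    have h := eval_gegenbauer_succ_succ lam n x
    have hd := congrArg (fun p => (derivative p).eval x) (gegenbauer_succ_succ lam n)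
    simp only [derivative_mul, derivative_sub, derivative_C, derivative_X, eval_add, eval_mul,
      eval_sub, eval_C, eval_X, zero_mul, zero_add, mul_one] at hd
    linear_combination (gegenbauer lam (n + 1)).eval x * hd
      - (derivative (gegenbauer lam (n + 1))).eval x * h
  induction n with
  | zero =>
    have h := hrec 0
    have hp : 0 < lam ^ 2 := by positivity
    have hq : 0 ≤ (1 + lam) * (gegenbauer lam 1).eval x ^ 2 :=
      mul_nonneg (by linarith) (sq_nonneg _)
    have hT : (derivative (gegenbauer lam 1)).eval x * (gegenbauer lam 0).eval x
      - (gegenbauer lam 1).eval x * (derivative (gegenbauer lam 0)).eval x = 2 * lam := by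
      simp [gegenbauer]
    simp only [zero_add, Nat.cast_zero] at h ⊢
    rw [hT] at h
    nlinarith
  | succ n ih =>
    have h := hrec (n + 1)
    have hn : (0 : ℝ) ≤ n := by positivity
    push_cast at h
    refine pos_of_mul_pos_right (a := (n : ℝ) + 1 + 2) ?_ (by positivity)
    rw [h]
    have hq' := mul_nonneg (by linarith : 0 ≤ 2 * ((n : ℝ) + 1 + 1 + lam))
      (sq_nonneg ((gegenbauer lam (n + 1 + 1)).eval x))
    have := mul_pos (by linarith : 0 < (n : ℝ) + 1 + 2 * lam) ih
    linarith

lemma mul_eval_gegenbauer_pos (hlam : -(1 / 2 : ℝ) < lam) (hlam0 : lam ≠ 0) {x : ℝ}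
    (hx : 1 ≤ x) (n : ℕ) : 0 < lam * (gegenbauer lam (n + 1)).eval x := by
  have hl : 0 < lam ^ 2 := by positivity
  have hprod : ∀ {a b : ℝ}, 0 < lam * a → 0 < lam * b → 0 < a * b := by
    intro a b ha hb
    have : 0 < lam ^ 2 * (a * b) := by nlinarith [mul_pos ha hb]
    exact pos_of_mul_pos_right this hl.le
  have hone : ∀ n, 0 < lam * (gegenbauer lam (n + 1)).eval 1 := fun n => by
    rw [eval_one_gegenbauer]; exact mul_risingCoeff_two_mul_pos hlam hlam0 n
  have hrec : ∀ n : ℕ, ((n : ℝ) + 2) *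
      ((gegenbauer lam (n + 2)).eval x * (gegenbauer lam (n + 1)).eval 1
      - (gegenbauer lam (n + 1)).eval x * (gegenbauer lam (n + 2)).eval 1)
      = 2 * (n + 1 + lam) * (x - 1) *
        ((gegenbauer lam (n + 1)).eval x * (gegenbauer lam (n + 1)).eval 1)
      + (n + 2 * lam) * ((gegenbauer lam (n + 1)).eval x * (gegenbauer lam n).eval 1
      - (gegenbauer lam n).eval x * (gegenbauer lam (n + 1)).eval 1) := by
    intro n
    linear_combination (gegenbauer lam (n + 1)).eval 1 * eval_gegenbauer_succ_succ lam n x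
      - (gegenbauer lam (n + 1)).eval x * eval_gegenbauer_succ_succ lam n 1
  -- The second conjunct says that C_n(x) / C_n(1) does not decrease with n when x ≥ 1; it carries
  -- the sign from one index to the next.
  suffices H : 0 < lam * (gegenbauer lam (n + 1)).eval x ∧
      0 ≤ (gegenbauer lam (n + 2)).eval x * (gegenbauer lam (n + 1)).eval 1
      - (gegenbauer lam (n + 1)).eval x * (gegenbauer lam (n + 2)).eval 1 from H.1
  induction n with
  | zero =>
    have e : ∀ y : ℝ, (gegenbauer lam 1).eval y = 2 * lam * y := fun y => by simp [gegenbauer]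
    have e0 : ∀ y : ℝ, (gegenbauer lam 0).eval y = 1 := fun y => by simp [gegenbauer]
    have h := hrec 0
    simp only [zero_add, Nat.cast_zero, e, e0] at h ⊢
    refine ⟨by nlinarith, ?_⟩
    have h1 : 0 ≤ (1 + lam) * (x - 1) * (lam ^ 2 * x) := by
      have := sub_nonneg.mpr hx
      have := sub_nonneg.mpr hlam.le
      have : 0 ≤ 1 + lam := by linarith
      positivity
    nlinarith [mul_nonneg hl.le (sub_nonneg.mpr hx)]
  | succ n ih =>
    obtain ⟨ih1, ih2⟩ := ih
    have h1 : 0 < lam * (gegenbauer lam (n + 2)).eval x := by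
      have hp := mul_pos ih1 (hone (n + 1))
      have hr := mul_nonneg hl.le ih2
      refine pos_of_mul_pos_left (b := lam * (gegenbauer lam (n + 1)).eval 1) ?_ (hone n).le
      nlinarith
    refine ⟨h1, ?_⟩
    have h := hrec (n + 1)
    have hn : (0 : ℝ) ≤ n := by positivity
    push_cast at h
    refine nonneg_of_mul_nonneg_right (a := (n : ℝ) + 1 + 2) ?_ (by positivity)
    rw [h]
    have e1 := mul_nonneg (mul_nonneg (by linarith : 0 ≤ 2 * ((n : ℝ) + 1 + 1 + lam))
      (sub_nonneg.mpr hx)) (hprod h1 (hone (n + 1))).le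
    have e2 := mul_nonneg (by linarith : 0 ≤ (n : ℝ) + 1 + 2 * lam) ih2
    linarith

lemma abs_lt_one_of_eval_gegenbauer_eq_zero (hlam : -(1 / 2 : ℝ) < lam) (hlam0 : lam ≠ 0)
    {n : ℕ} {x : ℝ} (hx : (gegenbauer lam (n + 1)).eval x = 0) : |x| < 1 := by
  by_contra! h
  rcases le_abs.mp h with h | h
  · have := mul_eval_gegenbauer_pos hlam hlam0 h n
    simp [hx] at this
  · have := mul_eval_gegenbauer_pos hlam hlam0 h n
    simp [eval_neg_gegenbauer, hx] at this

lemma card_roots_gegenbauer (hlam : -(1 / 2 : ℝ) < lam) (hlam0 : lam ≠ 0) (n : ℕ) :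
    (gegenbauer lam (n + 1)).roots.card = n + 1 := by
  obtain ⟨q, hq, hdeg, hroots⟩ := exists_prod_multiset_X_sub_C_mul (gegenbauer lam (n + 1))
  rw [natDegree_gegenbauer hlam hlam0] at hdeg
  -- A nonconstant cofactor q would have a complex root, which must be real, whereas q has no real
  -- roots.
  suffices q.natDegree = 0 by omega
  by_contra hne
  have hq0 : q ≠ 0 := by rintro rfl; simp at hne
  obtain ⟨z, hz⟩ := IsAlgClosed.exists_aeval_eq_zero ℂ q
    (fun h => hne (natDegree_eq_zero_iff_degree_le_zero.mpr h.le))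
  have hz' : aeval z (gegenbauer lam (n + 1)) = 0 := by rw [← hq, map_mul, hz, mul_zero]
  have him := im_eq_zero_of_aeval_gegenbauer_eq_zero hlam hlam0 hz'
  have hzx : z = algebraMap ℝ ℂ z.re := Complex.ext (by simp) (by simp [him])
  rw [hzx, aeval_algebraMap_apply, coe_aeval_eq_eval, Complex.coe_algebraMap,
    Complex.ofReal_eq_zero] at hz
  have : z.re ∈ q.roots := (mem_roots hq0).mpr hz
  simp [hroots] at this

lemma nodup_roots_gegenbauer (hlam : -(1 / 2 : ℝ) < lam) (hlam0 : lam ≠ 0) (n : ℕ) :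
    (gegenbauer lam (n + 1)).roots.Nodup := by
  rw [Multiset.nodup_iff_count_le_one]
  intro x
  rw [count_roots]
  by_contra! h
  obtain ⟨h1, h2⟩ := (one_lt_rootMultiplicity_iff_isRoot (gegenbauer_ne_zero hlam hlam0 _)).mp h
  have := gegenbauer_wronskian_pos hlam hlam0 x n
  rw [IsRoot.def] at h1 h2
  simp [h1, h2] at this

lemma card_gegenbauerGauss (hlam : -(1 / 2 : ℝ) < lam) (hlam0 : lam ≠ 0) (n : ℕ) :
    (gegenbauerGauss lam n).card = n + 1 := by
  rw [gegenbauerGauss, Multiset.toFinset_card_of_nodup (nodup_roots_gegenbauer hlam hlam0 n),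
    card_roots_gegenbauer hlam hlam0]

lemma mem_gegenbauerGauss (hlam : -(1 / 2 : ℝ) < lam) (hlam0 : lam ≠ 0) {n : ℕ} {x : ℝ} :
    x ∈ gegenbauerGauss lam n ↔ (gegenbauer lam (n + 1)).eval x = 0 := by
  rw [gegenbauerGauss, Multiset.mem_toFinset, mem_roots (gegenbauer_ne_zero hlam hlam0 _),
    IsRoot.def]

lemma abs_lt_one_of_mem_gegenbauerGauss (hlam : -(1 / 2 : ℝ) < lam) (hlam0 : lam ≠ 0)
    {n : ℕ} {x : ℝ} (hx : x ∈ gegenbauerGauss lam n) : |x| < 1 :=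
  abs_lt_one_of_eval_gegenbauer_eq_zero hlam hlam0 ((mem_gegenbauerGauss hlam hlam0).mp hx)

lemma gegenbauer_eq_C_mul_prod (hlam : -(1 / 2 : ℝ) < lam) (hlam0 : lam ≠ 0) (n : ℕ) :
    gegenbauer lam (n + 1) = C (gegenbauer lam (n + 1)).leadingCoeff *
      ∏ x ∈ gegenbauerGauss lam n, (X - C x) := by
  have h := C_leadingCoeff_mul_prod_multiset_X_sub_C (p := gegenbauer lam (n + 1))
    ((card_roots_gegenbauer hlam hlam0 n).trans (natDegree_gegenbauer hlam hlam0 _).symm)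
  rw [Finset.prod, gegenbauerGauss, Multiset.toFinset_val,
    (nodup_roots_gegenbauer hlam hlam0 n).dedup, h]

end Zeros

/-! ### Asymptotics of the coefficients and lower bound on the ellipse. -/

section Asymptotics

variable {lam : ℝ}

/-- The quotient is n/(s + n) divided by Gauss's product n^s n! / (s(s+1)⋯(s+n)). -/
lemma tendsto_risingCoeff_div_rpow {s : ℝ} (hs : ∀ m : ℕ, s ≠ -m) :
    Tendsto (fun n : ℕ => risingCoeff s n / (n : ℝ) ^ (s - 1)) atTop (𝓝 (Real.Gamma s)⁻¹) := by
  have hG := (Real.GammaSeq_tendsto_Gamma s).inv₀ (Real.Gamma_ne_zero hs)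
  have h1 : Tendsto (fun n : ℕ => (0 + 1 * (n : ℝ)) / (s + 1 * n)) atTop (𝓝 (1 / 1)) :=
    tendsto_add_mul_div_add_mul_atTop_nhds 0 s 1 one_ne_zero
  have h := h1.mul hG
  rw [div_one, one_mul] at h
  refine h.congr' ?_
  filter_upwards [eventually_gt_atTop 0] with n hn
  have hn' : (0 : ℝ) < n := by exact_mod_cast hn
  have hsn : s + n ≠ 0 := fun h => hs n (by linarith)
  have hpow : (0 : ℝ) < (n : ℝ) ^ s := Real.rpow_pos_of_pos hn' s
  have hf : (n.factorial : ℝ) = ∏ j ∈ Finset.range n, ((j : ℝ) + 1) := by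
    rw [← Finset.prod_range_add_one_eq_factorial]; push_cast; rfl
  have hf0 : (n.factorial : ℝ) ≠ 0 := by positivity
  rw [Real.GammaSeq, Finset.prod_range_succ, risingCoeff, Finset.prod_div_distrib, ← hf,
    Real.rpow_sub_one hn'.ne']
  field_simp
  ring

lemma tendsto_risingCoeff_shift (hlam : -(1 / 2 : ℝ) < lam) (hlam0 : lam ≠ 0) (k : ℕ) :
    Tendsto (fun n : ℕ => risingCoeff lam n / risingCoeff lam (n + k)) atTop (𝓝 1) := by
  have hne := risingCoeff_ne_zero hlam hlam0
  induction k with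
  | zero => simp [hne]
  | succ k ih =>
    have h1 : Tendsto (fun n : ℕ => ((1 : ℝ) + 1 * (n : ℝ)) / (lam + 1 * n)) atTop (𝓝 (1 / 1)) :=
      tendsto_add_mul_div_add_mul_atTop_nhds 1 lam 1 one_ne_zero
    have h2 := ih.mul (h1.comp (tendsto_add_atTop_nat k))
    rw [div_one, one_mul] at h2
    refine h2.congr fun n => ?_
    have e := risingCoeff_succ lam (n + k)
    have hz : lam + ((n + k : ℕ) : ℝ) ≠ 0 := by
      intro h0
      rw [h0, zero_mul] at e
      exact mul_ne_zero (by positivity) (hne _) e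
    have := hne (n + k)
    have := hne (n + (k + 1))
    simp only [Function.comp, one_mul]
    rw [← add_assoc] at *
    field_simp
    linear_combination risingCoeff lam n * e

/-- One step amounts to (λ + n)(n + 1) ≥ n², true for λ > -1/2 once n ≥ 1. It leads to a bound on
a_{n-k}/a_n that is polynomial in k and uniform in n. -/
lemma norm_risingCoeff_mul_sq_le (hlam : -(1 / 2 : ℝ) < lam) {m n : ℕ} (hm : 1 ≤ m)
    (hmn : m ≤ n) :
    |risingCoeff lam m| * (m : ℝ) ^ 2 ≤ |risingCoeff lam n| * (n : ℝ) ^ 2 := by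
  induction n, hmn using Nat.le_induction with
  | base => exact le_rfl
  | succ n hmn ih =>
    refine ih.trans ?_
    have hn : (1 : ℝ) ≤ n := by exact_mod_cast hm.trans hmn
    rw [risingCoeff_succ', abs_mul, mul_assoc]
    refine mul_le_mul_of_nonneg_left ?_ (abs_nonneg _)
    rw [abs_of_pos (div_pos (by linarith) (by linarith)), div_mul_eq_mul_div,
      le_div_iff₀ (by linarith)]
    push_cast
    nlinarith [mul_nonneg (by linarith : (0 : ℝ) ≤ (n - 1)) (by linarith : (0 : ℝ) ≤ lam + 1 / 2),
      mul_nonneg (mul_nonneg (by linarith : (0 : ℝ) ≤ (n - 1)) (by linarith : (0 : ℝ) ≤ n))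
        (by linarith : (0 : ℝ) ≤ lam + 1 / 2)]

lemma abs_risingCoeff_div_le (hlam : -(1 / 2 : ℝ) < lam) (hlam0 : lam ≠ 0) {n k : ℕ}
    (hn : 1 ≤ n) (hk : k ≤ n) :
    |risingCoeff lam (n - k) / risingCoeff lam n| ≤ (1 + |lam|⁻¹) * ((k : ℝ) + 1) ^ 2 := by
  have hpos : 0 < |risingCoeff lam n| := abs_pos.mpr (risingCoeff_ne_zero hlam hlam0 n)
  have hl : 0 < |lam| := abs_pos.mpr hlam0
  have hn1 : (1 : ℝ) ≤ n := by exact_mod_cast hn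
  rw [abs_div, div_le_iff₀ hpos]
  -- For k < n, n ≤ (n - k)(k + 1). The case k = n is separate, as monotonicity starts at index 1;
  -- comparing a_0 = 1 with a_1 = λ costs the factor |λ|⁻¹.
  rcases hk.lt_or_eq with hlt | rfl
  · have h := norm_risingCoeff_mul_sq_le hlam (show 1 ≤ n - k by omega) (Nat.sub_le n k)
    have hm : (1 : ℝ) ≤ ((n - k : ℕ) : ℝ) := by exact_mod_cast (show 1 ≤ n - k by omega)
    have hnk : (n : ℝ) = ((n - k : ℕ) : ℝ) + k := by
      rw [Nat.cast_sub hk]; ring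
    generalize ((n - k : ℕ) : ℝ) = m at *
    have hk0 : (0 : ℝ) ≤ k := by positivity
    have hle : (n : ℝ) ≤ m * (k + 1) := by rw [hnk]; nlinarith
    have hsq : (n : ℝ) ^ 2 ≤ m ^ 2 * (k + 1) ^ 2 := by
      rw [← mul_pow]; exact pow_le_pow_left₀ (by linarith) hle 2
    have h2 : |risingCoeff lam (n - k)| * m ^ 2 ≤
        ((k + 1) ^ 2 * |risingCoeff lam n|) * m ^ 2 := by
      refine h.trans ((mul_le_mul_of_nonneg_left hsq hpos.le).trans (le_of_eq (by ring)))
    have h3 := le_of_mul_le_mul_right h2 (by positivity)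
    refine h3.trans ?_
    have : (0 : ℝ) ≤ |lam|⁻¹ * ((k + 1) ^ 2 * |risingCoeff lam n|) := by positivity
    linarith
  · have h := norm_risingCoeff_mul_sq_le hlam le_rfl hn
    have h1 : risingCoeff lam 1 = lam := by simp [risingCoeff]
    rw [h1] at h
    simp only [Nat.sub_self, risingCoeff_zero, abs_one]
    have h2 : 1 ≤ |lam|⁻¹ * (|risingCoeff lam k| * (k : ℝ) ^ 2) := by
      rw [inv_mul_eq_div, le_div_iff₀ hl]; simpa using h
    refine h2.trans ?_
    have h3 : (k : ℝ) ^ 2 ≤ ((k : ℝ) + 1) ^ 2 := by nlinarith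
    calc |lam|⁻¹ * (|risingCoeff lam k| * (k : ℝ) ^ 2)
        ≤ |lam|⁻¹ * (|risingCoeff lam k| * ((k : ℝ) + 1) ^ 2) := by gcongr
      _ ≤ _ := by
        have : 0 ≤ |risingCoeff lam k| * ((k : ℝ) + 1) ^ 2 := by positivity
        nlinarith

lemma summable_risingCoeff_mul (hlam : -(1 / 2 : ℝ) < lam) (hlam0 : lam ≠ 0) {Q : ℝ}
    (hQ0 : 0 < Q) (hQ : Q < 1) :
    Summable fun k : ℕ => |risingCoeff lam k| * ((k : ℝ) + 1) ^ 2 * Q ^ k := by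
  have hne := risingCoeff_ne_zero hlam hlam0
  refine summable_of_ratio_test_tendsto_lt_one hQ
    (Eventually.of_forall fun k => mul_ne_zero (mul_ne_zero (abs_ne_zero.mpr (hne k))
      (by positivity)) (by positivity)) ?_
  have h1 : Tendsto (fun n : ℕ => (lam + 1 * (n : ℝ)) / (1 + 1 * n)) atTop (𝓝 (1 / 1)) :=
    tendsto_add_mul_div_add_mul_atTop_nhds lam 1 1 one_ne_zero
  have h2 : Tendsto (fun n : ℕ => (2 + 1 * (n : ℝ)) / (1 + 1 * n)) atTop (𝓝 (1 / 1)) :=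
    tendsto_add_mul_div_add_mul_atTop_nhds 2 1 1 one_ne_zero
  have h := (h1.abs.mul (h2.pow 2)).mul_const Q
  rw [div_one, abs_one, one_pow, one_mul, one_mul] at h
  refine h.congr fun k => ?_
  have hk : 0 < |risingCoeff lam k| := abs_pos.mpr (hne k)
  rw [Real.norm_of_nonneg (by positivity), Real.norm_of_nonneg (by positivity), risingCoeff_succ',
    abs_mul, pow_succ Q]
  push_cast
  rw [one_mul, add_comm (1 : ℝ) k, show (k : ℝ) + 1 + 1 = 2 + k by ring]
  field_simp

lemma ring_choose_eq_risingCoeff (s : ℝ) (n : ℕ) :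
    Ring.choose ((s : ℂ) + n - 1) n = (risingCoeff s n : ℂ) := by
  have e : (s : ℂ) + n - 1 - n + 1 = s := by ring
  have h := Ring.factorial_nsmul_multichoose_eq_ascPochhammer (s : ℂ) n
  rw [ascPochhammer_smeval_eq_eval, nsmul_eq_mul] at h
  rw [Ring.choose, e]
  have hf : (n.factorial : ℂ) ≠ 0 := by exact_mod_cast n.factorial_ne_zero
  apply mul_left_cancel₀ hf
  rw [h]
  clear h hf e
  induction n with
  | zero => simp
  | succ n ih =>
    have hs : ((n : ℂ) + 1) * (risingCoeff s (n + 1) : ℂ) = (s + n) * risingCoeff s n := by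
      exact_mod_cast congrArg (fun x : ℝ => (x : ℂ)) (risingCoeff_succ s n)
    rw [ascPochhammer_succ_eval, ih, Nat.factorial_succ]
    push_cast
    linear_combination -(n.factorial : ℂ) * hs

lemma hasSum_risingCoeff (s : ℝ) {q : ℂ} (hq : ‖q‖ < 1) :
    HasSum (fun k : ℕ => (risingCoeff s k : ℂ) * q ^ k) (1 / (1 - q) ^ (s : ℂ)) := by
  have h := (Complex.one_div_one_sub_cpow_hasFPowerSeriesOnBall_zero (s : ℂ)).hasSum
    (y := q) (by rw [Metric.mem_eball, edist_zero_right, ← ofReal_norm, ENNReal.ofReal_lt_one]; exact hq)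
  simpa [ring_choose_eq_risingCoeff, FormalMultilinearSeries.ofScalars, mul_comm] using h

/-- The factor `(1 ± ρ⁻²) ^ λ` of the error constant. -/
noncomputable def ellipseFactor (lam rho : ℝ) : ℝ :=
  if 0 < lam then (1 + (rho ^ 2)⁻¹) ^ lam else (1 - (rho ^ 2)⁻¹) ^ lam

lemma ellipseFactor_pos {rho : ℝ} (hrho : 1 < rho) : 0 < ellipseFactor lam rho := by
  have : (rho ^ 2)⁻¹ < 1 := inv_lt_one_of_one_lt₀ (by nlinarith)
  unfold ellipseFactor
  split_ifs
  · positivity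
  · exact Real.rpow_pos_of_pos (by linarith) _

/-- |1 - q| lies between 1 - ρ⁻² and 1 + ρ⁻²; the sign of λ decides which end is extremal. -/
lemma inv_ellipseFactor_le {rho : ℝ} (hrho : 1 < rho) {q : ℂ} (hq : ‖q‖ = (rho ^ 2)⁻¹) :
    (ellipseFactor lam rho)⁻¹ ≤ ‖1 / (1 - q) ^ (lam : ℂ)‖ := by
  have h1 : (rho ^ 2)⁻¹ < 1 := inv_lt_one_of_one_lt₀ (by nlinarith)
  have hlow : 1 - (rho ^ 2)⁻¹ ≤ ‖1 - q‖ := by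
    simpa [hq] using norm_sub_norm_le (1 : ℂ) q
  have hupp : ‖1 - q‖ ≤ 1 + (rho ^ 2)⁻¹ := by
    simpa [hq] using norm_sub_le (1 : ℂ) q
  have hpos : 0 < ‖1 - q‖ := by linarith
  rw [norm_div, norm_one, Complex.norm_cpow_real, one_div]
  refine inv_anti₀ (Real.rpow_pos_of_pos hpos _) ?_
  unfold ellipseFactor
  split_ifs with h
  · exact Real.rpow_le_rpow hpos.le hupp h.le
  · exact Real.rpow_le_rpow_of_nonpos (by linarith) hlow (not_lt.mp h)

/-- Uniform convergence of the normalized convolution sums. -/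
lemma exists_tendsto_zero_norm_sub_le (hlam : -(1 / 2 : ℝ) < lam) (hlam0 : lam ≠ 0) {Q : ℝ}
    (hQ0 : 0 < Q) (hQ : Q < 1) :
    ∃ e : ℕ → ℝ, Tendsto e atTop (𝓝 0) ∧ ∀ n : ℕ, 1 ≤ n → ∀ q : ℂ, ‖q‖ = Q →
      ‖(∑ p ∈ Finset.HasAntidiagonal.antidiagonal n,
        (risingCoeff lam p.1 : ℂ) * q ^ p.1 * risingCoeff lam p.2) / risingCoeff lam n
          - 1 / (1 - q) ^ (lam : ℂ)‖ ≤ e n := by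
  have hne := risingCoeff_ne_zero hlam hlam0
  -- Tannery's argument: the finite convolution becomes a full series with weights a_{n-k}/a_n,
  -- extended by zero for k > n. Each weight tends to 1, and `bd` dominates.
  set g : ℕ → ℕ → ℝ := fun n k =>
    if k ≤ n then risingCoeff lam (n - k) / risingCoeff lam n else 0 with hg
  set K : ℝ := 1 + |lam|⁻¹ with hK
  have hK1 : 0 ≤ |lam|⁻¹ := by positivity
  set bd : ℕ → ℝ := fun k => (K + 1) * (|risingCoeff lam k| * ((k : ℝ) + 1) ^ 2 * Q ^ k) with hbd
  have hbs : Summable bd := (summable_risingCoeff_mul hlam hlam0 hQ0 hQ).mul_left _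
  have hbound : ∀ n, 1 ≤ n → ∀ k,
      ‖|risingCoeff lam k| * |g n k - 1| * Q ^ k‖ ≤ bd k := by
    intro n hn k
    rw [Real.norm_of_nonneg (by positivity)]
    have h1 : (1 : ℝ) ≤ ((k : ℝ) + 1) ^ 2 := by
      have : (0 : ℝ) ≤ k := by positivity
      nlinarith
    have h2 : |g n k - 1| ≤ (K + 1) * ((k : ℝ) + 1) ^ 2 := by
      refine (abs_sub _ _).trans ?_
      have : |g n k| ≤ K * ((k : ℝ) + 1) ^ 2 := by
        simp only [hg]
        split_ifs with h
        · exact abs_risingCoeff_div_le hlam hlam0 hn h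
        · rw [abs_zero]; positivity
      rw [abs_one]
      linarith
    calc |risingCoeff lam k| * |g n k - 1| * Q ^ k
        ≤ |risingCoeff lam k| * ((K + 1) * ((k : ℝ) + 1) ^ 2) * Q ^ k := by gcongr
      _ = bd k := by rw [hbd]; ring
  refine ⟨fun n => ∑' k, |risingCoeff lam k| * |g n k - 1| * Q ^ k, ?_, ?_⟩
  · have h := tendsto_tsum_of_dominated_convergence (𝓕 := atTop)
      (f := fun n k => |risingCoeff lam k| * |g n k - 1| * Q ^ k) (g := fun _ => (0 : ℝ)) hbs ?_
      ((eventually_ge_atTop 1).mono hbound)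
    · simpa using h
    · intro k
      have h1 : Tendsto (fun n => g n k) atTop (𝓝 1) := by
        rw [← tendsto_add_atTop_iff_nat k]
        refine (tendsto_risingCoeff_shift hlam hlam0 k).congr fun n => ?_
        simp [hg]
      have h2 := (((h1.sub_const 1).abs).const_mul |risingCoeff lam k|).mul_const (Q ^ k)
      simpa using h2
  · intro n hn q hq
    have hs := hasSum_risingCoeff lam (q := q) (by rw [hq]; exact hQ)
    have hg' : HasSum (fun k : ℕ => (risingCoeff lam k : ℂ) * (g n k : ℂ) * q ^ k)
        ((∑ p ∈ Finset.HasAntidiagonal.antidiagonal n,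
        (risingCoeff lam p.1 : ℂ) * q ^ p.1 * risingCoeff lam p.2) / risingCoeff lam n) := by
      rw [Finset.Nat.sum_antidiagonal_eq_sum_range_succ_mk, Finset.sum_div]
      have h := hasSum_sum_of_ne_finset_zero (L := .unconditional ℕ)
        (f := fun k : ℕ => (risingCoeff lam k : ℂ) * (g n k : ℂ) * q ^ k)
        (s := Finset.range n.succ) (fun k hk => by
          have : ¬ k ≤ n := fun h => hk (Finset.mem_range.mpr (by omega))
          simp [hg, this])
      convert h using 1
      refine Finset.sum_congr rfl fun k hk => ?_
      have : k ≤ n := by have := Finset.mem_range.mp hk; omega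
      simp only [hg, this, if_true]
      push_cast
      ring
    have hd := hg'.sub hs
    rw [← hd.tsum_eq]
    have hsum : Summable fun k => |risingCoeff lam k| * |g n k - 1| * Q ^ k :=
      Summable.of_norm_bounded hbs (hbound n hn)
    refine tsum_of_norm_bounded hsum.hasSum fun k => ?_
    rw [← sub_mul, ← mul_sub_one, norm_mul, norm_mul, norm_pow, hq, Complex.norm_real,
      Real.norm_eq_abs, ← Complex.ofReal_one, ← Complex.ofReal_sub, Complex.norm_real,
      Real.norm_eq_abs]

lemma joukowski_sub_eq {v z : ℂ} (hv : v ≠ 0) (hz : z ≠ 0) :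
    (v + v⁻¹) / 2 - (z + z⁻¹) / 2 = (v - z) * (v - z⁻¹) / (2 * v) := by
  field_simp
  ring

/-- Writing x = (z + z⁻¹)/2 with |z| = 1, the difference factors as (v - z)(v - z⁻¹)/(2v), and both
factors have modulus at least 1 - r. -/
lemma le_norm_joukowski_sub {r : ℝ} (hr0 : 0 < r) (hr : r < 1) {v : ℂ} (hv : ‖v‖ = r) {x : ℝ}
    (hx : |x| ≤ 1) : (1 - r) ^ 2 / (2 * r) ≤ ‖(v + v⁻¹) / 2 - x‖ := by
  obtain ⟨z, hz, hxz⟩ := exists_norm_eq_one_joukowski hx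
  have hz0 : z ≠ 0 := by rintro rfl; simp at hz
  have hv0 : v ≠ 0 := by rintro rfl; simp at hv; linarith
  have h : ∀ y : ℂ, ‖y‖ = 1 → 1 - r ≤ ‖v - y‖ := fun y hy => by
    rw [norm_sub_rev, ← hv, ← hy]
    exact norm_sub_norm_le _ _
  rw [hxz, joukowski_sub_eq hv0 hz0, norm_div, norm_mul, norm_mul, hv, sq, Complex.norm_two]
  have h1r := sub_pos.mpr hr
  gcongr
  · exact h z hz
  · exact h _ (by rw [norm_inv, hz, inv_one])

lemma aeval_gegenbauer_joukowski_ne_zero (hlam : -(1 / 2 : ℝ) < lam) (hlam0 : lam ≠ 0) {v : ℂ}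
    (hv0 : v ≠ 0) (hv : ‖v‖ < 1) (n : ℕ) :
    aeval ((v + v⁻¹) / 2) (gegenbauer lam (n + 1)) ≠ 0 := by
  intro h
  have him := im_eq_zero_of_aeval_gegenbauer_eq_zero hlam hlam0 h
  set z := (v + v⁻¹) / 2 with hz
  have hzx : z = algebraMap ℝ ℂ z.re := Complex.ext (by simp) (by simp [him])
  rw [hzx, aeval_algebraMap_apply, coe_aeval_eq_eval, Complex.coe_algebraMap,
    Complex.ofReal_eq_zero] at h
  have hx := abs_lt_one_of_eval_gegenbauer_eq_zero hlam hlam0 h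
  have hvp := norm_pos_iff.mpr hv0
  have hd := le_norm_joukowski_sub hvp hv rfl hx.le
  rw [← hz, show ((z.re : ℝ) : ℂ) = z from hzx.symm, sub_self, norm_zero] at hd
  have : 0 < (1 - ‖v‖) ^ 2 / (2 * ‖v‖) := by
    have := sub_pos.mpr hv
    positivity
  linarith

/-- The asymptotically sharp lower bound for `C_{n+1}^λ` on the Bernstein ellipse. -/
lemma exists_lower_bound_gegenbauer (hlam : -(1 / 2 : ℝ) < lam) (hlam0 : lam ≠ 0) {rho : ℝ}
    (hrho : 1 < rho) :
    ∃ m : ℕ → ℝ, (∀ n, 0 < m n) ∧ Tendsto m atTop (𝓝 (ellipseFactor lam rho)⁻¹) ∧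
      ∀ n, ∀ v : ℂ, ‖v‖ = rho⁻¹ → m n * |risingCoeff lam (n + 1)| * rho ^ (n + 1) ≤
        ‖aeval ((v + v⁻¹) / 2) (gegenbauer lam (n + 1))‖ := by
  classical
  have hrho0 : 0 < rho := by linarith
  have hr1 : rho⁻¹ < 1 := inv_lt_one_of_one_lt₀ hrho
  have hr0 : 0 < rho⁻¹ := by positivity
  have hQ1 : (rho ^ 2)⁻¹ < 1 := inv_lt_one_of_one_lt₀ (by nlinarith)
  obtain ⟨e, he0, he⟩ := exists_tendsto_zero_norm_sub_le hlam hlam0 (Q := (rho ^ 2)⁻¹)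
    (by positivity) hQ1
  set K := ellipseFactor lam rho
  have hK : 0 < K⁻¹ := inv_pos.mpr (ellipseFactor_pos hrho)
  have hne := risingCoeff_ne_zero hlam hlam0
  have hv0 : ∀ {v : ℂ}, ‖v‖ = rho⁻¹ → v ≠ 0 := fun {v} hv h => by
    rw [h, norm_zero] at hv; linarith
  -- Compactness and the absence of zeros give some positive bound for each n; it serves only where
  -- the asymptotic bound is not yet positive.
  have hloc : ∀ n, ∃ b : ℝ, 0 < b ∧ ∀ v : ℂ, ‖v‖ = rho⁻¹ →
      b * |risingCoeff lam (n + 1)| * rho ^ (n + 1) ≤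
        ‖aeval ((v + v⁻¹) / 2) (gegenbauer lam (n + 1))‖ := by
    intro n
    have hcont : ContinuousOn (fun v : ℂ => ‖aeval ((v + v⁻¹) / 2) (gegenbauer lam (n + 1))‖)
        (Metric.sphere 0 rho⁻¹) := by
      refine ((gegenbauer lam (n + 1)).continuous_aeval.comp_continuousOn ?_).norm
      exact (continuousOn_id.add (continuousOn_id.inv₀ fun v hv => hv0 (by simpa using hv))).div_const 2
    obtain ⟨v₀, hv₀, hmin⟩ := (isCompact_sphere (0 : ℂ) rho⁻¹).exists_isMinOn
      ⟨(rho⁻¹ : ℝ), by simp [abs_of_pos hrho0]⟩ hcont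
    have hv₀' : ‖v₀‖ = rho⁻¹ := by simpa using hv₀
    have hpos := norm_pos_iff.mpr
      (aeval_gegenbauer_joukowski_ne_zero hlam hlam0 (hv0 hv₀') (hv₀' ▸ hr1) n)
    have ha := abs_pos.mpr (hne (n + 1))
    refine ⟨‖aeval ((v₀ + v₀⁻¹) / 2) (gegenbauer lam (n + 1))‖ /
      (|risingCoeff lam (n + 1)| * rho ^ (n + 1)), by positivity, fun v hv => ?_⟩
    rw [mul_assoc, div_mul_cancel₀ _ (by positivity)]
    exact hmin (by simpa using hv)
  choose b hb0 hb using hloc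
  refine ⟨fun n => if e (n + 1) < K⁻¹ then K⁻¹ - e (n + 1) else b n, fun n => ?_, ?_,
    fun n v hv => ?_⟩
  · dsimp only
    split_ifs with h
    · exact sub_pos.mpr h
    · exact hb0 n
  · have he1 := he0.comp (tendsto_add_atTop_nat 1)
    have h := he1.const_sub K⁻¹
    rw [sub_zero] at h
    refine h.congr' ?_
    filter_upwards [he1.eventually_lt_const hK] with n hn
    rw [Function.comp] at hn
    simp [hn]
  · dsimp only
    split_ifs with h
    · have h1 := he (n + 1) (by omega) (v ^ 2) (by rw [norm_pow, hv, inv_pow])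
      have h2 := inv_ellipseFactor_le (lam := lam) hrho (q := v ^ 2)
        (by rw [norm_pow, hv, inv_pow])
      rw [← pow_mul_aeval_gegenbauer lam (n + 1) (hv0 hv)] at h1
      have h3 := norm_sub_norm_le (1 / (1 - v ^ 2) ^ (lam : ℂ))
        (v ^ (n + 1) * aeval ((v + v⁻¹) / 2) (gegenbauer lam (n + 1)) / risingCoeff lam (n + 1))
      rw [norm_sub_rev] at h3
      have h4 : K⁻¹ - e (n + 1) ≤ ‖v ^ (n + 1) * aeval ((v + v⁻¹) / 2) (gegenbauer lam (n + 1)) /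
          risingCoeff lam (n + 1)‖ := by linarith
      rw [norm_div, norm_mul, norm_pow, hv, Complex.norm_real, Real.norm_eq_abs,
        le_div_iff₀ (abs_pos.mpr (hne _)), inv_pow, inv_mul_eq_div,
        le_div_iff₀ (by positivity)] at h4
      exact h4
    · exact hb n v hv

end Asymptotics

/-! ### Contour integrals over the Bernstein ellipse. -/

section Ellipse

/-- The circle |v| = t goes to the confocal ellipse with semi-axes (t⁻¹ ± t)/2, and these decrease
in t. -/
lemma joukowski_mem_bernsteinRegion {rho : ℝ} (hrho : 1 < rho) {v : ℂ} (h1 : rho⁻¹ ≤ ‖v‖)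
    (h2 : ‖v‖ ≤ 1) : (v + v⁻¹) / 2 ∈ bernsteinRegion rho := by
  have hrho0 : 0 < rho := by linarith
  have hinv : rho⁻¹ < 1 := inv_lt_one_of_one_lt₀ hrho
  have hinv0 : 0 < rho⁻¹ := by positivity
  set t := ‖v‖ with ht
  have ht0 : 0 < t := hinv0.trans_le h1
  have hab : v.re ^ 2 + v.im ^ 2 = t ^ 2 := by
    rw [ht, Complex.sq_norm, Complex.normSq_apply]; ring
  have hns : Complex.normSq v = t ^ 2 := by rw [ht, Complex.sq_norm]
  have hre : ((v + v⁻¹) / 2).re = v.re * (1 + (t ^ 2)⁻¹) / 2 := by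
    simp [Complex.inv_re, hns]; ring
  have him : ((v + v⁻¹) / 2).im = v.im * (1 - (t ^ 2)⁻¹) / 2 := by
    simp [Complex.inv_im, hns]; ring
  have htt : t⁻¹ ≤ rho := by
    rw [← inv_inv rho]; exact inv_anti₀ hinv0 h1
  have ht1 : 1 ≤ t⁻¹ := (one_le_inv₀ ht0).mpr h2
  have hsub : t⁻¹ - t ≤ rho - rho⁻¹ := by linarith
  have hadd : t + t⁻¹ ≤ rho + rho⁻¹ := by
    have e : rho + rho⁻¹ - (t + t⁻¹) = (rho - t⁻¹) * (1 - rho⁻¹ * t) := by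
      field_simp
      ring
    have : rho⁻¹ * t ≤ 1 := by nlinarith
    nlinarith [mul_nonneg (sub_nonneg.mpr htt) (sub_nonneg.mpr this)]
  have hA : 0 < rho + rho⁻¹ := by positivity
  have hB : 0 < rho - rho⁻¹ := by linarith
  rw [bernsteinRegion, Set.mem_ofPred_eq, hre, him]
  have e1 : (v.re * (1 + (t ^ 2)⁻¹) / 2 / ((rho + rho⁻¹) / 2)) ^ 2
      = v.re ^ 2 / t ^ 2 * ((t + t⁻¹) / (rho + rho⁻¹)) ^ 2 := by
    have e : 1 + (t ^ 2)⁻¹ = (t + t⁻¹) / t := by field_simp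
    rw [e]
    generalize rho + rho⁻¹ = A at *
    generalize t + t⁻¹ = s
    field_simp
  have e2 : (v.im * (1 - (t ^ 2)⁻¹) / 2 / ((rho - rho⁻¹) / 2)) ^ 2
      = v.im ^ 2 / t ^ 2 * ((t⁻¹ - t) / (rho - rho⁻¹)) ^ 2 := by
    have e : 1 - (t ^ 2)⁻¹ = -(t⁻¹ - t) / t := by field_simp; ring
    rw [e]
    generalize rho - rho⁻¹ = A at *
    generalize t⁻¹ - t = s
    field_simp
  rw [e1, e2]
  have f1 : ((t + t⁻¹) / (rho + rho⁻¹)) ^ 2 ≤ 1 :=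
    pow_le_one₀ (by positivity) ((div_le_one hA).mpr hadd)
  have f2 : ((t⁻¹ - t) / (rho - rho⁻¹)) ^ 2 ≤ 1 :=
    pow_le_one₀ (div_nonneg (by linarith) hB.le) ((div_le_one hB).mpr hsub)
  have g : v.re ^ 2 / t ^ 2 + v.im ^ 2 / t ^ 2 = 1 := by
    rw [← add_div, hab, div_self (by positivity)]
  have p1 : 0 ≤ v.re ^ 2 / t ^ 2 := by positivity
  have p2 : 0 ≤ v.im ^ 2 / t ^ 2 := by positivity
  nlinarith [mul_le_mul_of_nonneg_left f1 p1, mul_le_mul_of_nonneg_left f2 p2]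

lemma ofReal_mem_bernsteinRegion {rho : ℝ} (hrho : 1 < rho) {x : ℝ} (hx : |x| ≤ 1) :
    (x : ℂ) ∈ bernsteinRegion rho := by
  obtain ⟨v, hv, hxv⟩ := exists_norm_eq_one_joukowski hx
  rw [hxv]
  exact joukowski_mem_bernsteinRegion hrho (hv ▸ (inv_lt_one_of_one_lt₀ hrho).le) hv.le

/-- The integral of `f` along the ellipse parametrized by `v ↦ (v + v⁻¹) / 2`, `|v| = r`. -/
noncomputable def ellipseIntegral (r : ℝ) (f : ℂ → ℂ) : ℂ :=
  circleIntegral (fun v => (1 - (v ^ 2)⁻¹) / 2 * f ((v + v⁻¹) / 2)) 0 r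

/-- The contour is moved across the annulus to |v| = 1, where the ellipse collapses to the segment
[-1,1] run through in both directions. -/
lemma ellipseIntegral_eq_zero {rho : ℝ} (hrho : 1 < rho) {k : ℂ → ℂ}
    (hk : AnalyticOnNhd ℂ k (bernsteinRegion rho)) : ellipseIntegral rho⁻¹ k = 0 := by
  have hinv : rho⁻¹ < 1 := inv_lt_one_of_one_lt₀ hrho
  have hinv0 : 0 < rho⁻¹ := inv_pos.mpr (by linarith)
  have hdiff : ∀ v : ℂ, rho⁻¹ ≤ ‖v‖ → ‖v‖ ≤ 1 →
      DifferentiableAt ℂ (fun v : ℂ => (1 - (v ^ 2)⁻¹) / 2 * k ((v + v⁻¹) / 2)) v := by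
    intro v h1 h2
    have hv0 : v ≠ 0 := norm_pos_iff.mp (hinv0.trans_le h1)
    have hv2 : v ^ 2 ≠ 0 := pow_ne_zero 2 hv0
    have hk' := (hk _ (joukowski_mem_bernsteinRegion hrho h1 h2)).differentiableAt
    refine DifferentiableAt.mul (by fun_prop (disch := assumption)) ?_
    exact DifferentiableAt.comp v hk' (by fun_prop (disch := assumption))
  have hann := Complex.circleIntegral_eq_of_differentiable_on_annulus_off_countable (c := 0)
    hinv0 hinv.le (f := fun v : ℂ => (1 - (v ^ 2)⁻¹) / 2 * k ((v + v⁻¹) / 2))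
    Set.countable_empty
    (fun v hv => by
      simp only [Set.mem_sdiff, Metric.mem_closedBall, Metric.mem_ball, dist_zero_right,
        not_lt] at hv
      exact (hdiff v hv.2 hv.1).continuousAt.continuousWithinAt)
    (fun v hv => by
      simp only [Set.mem_sdiff, Metric.mem_closedBall, Metric.mem_ball, dist_zero_right,
        not_le, Set.mem_empty_iff_false, not_false_eq_true, and_true] at hv
      exact hdiff v hv.2.le hv.1.le)
  rw [ellipseIntegral, ← hann, circleIntegral]
  set f : ℝ → ℂ := fun θ => deriv (circleMap 0 1) θ •
    ((1 - (circleMap 0 1 θ ^ 2)⁻¹) / 2 * k ((circleMap 0 1 θ + (circleMap 0 1 θ)⁻¹) / 2)) with hf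
  -- θ ↦ 2π - θ inverts v, which fixes (v + v⁻¹)/2 and reverses the differential.
  have hodd : ∀ θ, f (2 * Real.pi - θ) = -f θ := by
    intro θ
    have hc : circleMap 0 1 (2 * Real.pi - θ) = (circleMap 0 1 θ)⁻¹ := by
      simp only [circleMap, zero_add, Complex.ofReal_one, one_mul]
      rw [← Complex.exp_neg]
      push_cast
      rw [sub_mul, sub_eq_add_neg, Complex.exp_add, Complex.exp_two_pi_mul_I, one_mul]
    have h0 : circleMap 0 1 θ ≠ 0 := circleMap_ne_center one_ne_zero
    simp only [hf, deriv_circleMap, hc, smul_eq_mul]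
    rw [inv_inv, add_comm (circleMap 0 1 θ)⁻¹]
    generalize k _ = y
    field_simp
    ring
  have h := intervalIntegral.integral_comp_sub_left (a := 0) (b := 2 * Real.pi) f (2 * Real.pi)
  simp only [hodd, sub_self, sub_zero, intervalIntegral.integral_neg] at h
  exact self_eq_neg.mp h.symm

lemma sq_sub_two_mul_add_one_ne_zero {x : ℝ} (hx : |x| ≤ 1) {v : ℂ} (hv : ‖v‖ < 1) :
    v ^ 2 - 2 * x * v + 1 ≠ 0 := by
  rcases eq_or_ne v 0 with rfl | h0
  · simp
  · have hp := norm_pos_iff.mpr h0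
    have hd := le_norm_joukowski_sub hp hv rfl hx
    have : 0 < (1 - ‖v‖) ^ 2 / (2 * ‖v‖) := by
      have := sub_pos.mpr hv
      positivity
    have hne := norm_pos_iff.mp (this.trans_le hd)
    have e : v ^ 2 - 2 * x * v + 1 = 2 * v * ((v + v⁻¹) / 2 - x) := by field_simp; ring
    rw [e]
    exact mul_ne_zero (mul_ne_zero two_ne_zero h0) hne

lemma joukowski_sub_inv {x : ℝ} {v : ℂ} (h0 : v ≠ 0) :
    ((v + v⁻¹) / 2 - x)⁻¹ = 2 * v * (v ^ 2 - 2 * x * v + 1)⁻¹ := by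
  have e : (v + v⁻¹) / 2 - x = (v ^ 2 - 2 * x * v + 1) / (2 * v) := by
    field_simp
    ring
  rw [e, inv_div, div_eq_mul_inv]

/-- Residue at v = 0: after the substitution, the kernels (z - x)⁻¹ and their products have no other
pole in the unit disc. -/
lemma ellipseIntegral_of_eq_inv_mul {r : ℝ} (hr0 : 0 < r) (hr : r < 1) {f g : ℂ → ℂ}
    (hg : ∀ v : ℂ, ‖v‖ < 1 → DifferentiableAt ℂ g v)
    (hfg : ∀ v : ℂ, ‖v‖ = r → (1 - (v ^ 2)⁻¹) / 2 * f ((v + v⁻¹) / 2) = v⁻¹ * g v) :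
    ellipseIntegral r f = 2 * Real.pi * Complex.I * g 0 := by
  have h := Complex.circleIntegral_sub_center_inv_smul_of_differentiable_on_off_countable hr0
    (f := g) (c := 0) Set.countable_empty
    (fun v hv => (hg v (by rw [mem_closedBall_zero_iff] at hv; linarith)).continuousAt.continuousWithinAt)
    (fun v hv => hg v (by have := mem_ball_zero_iff.mp hv.1; linarith))
  rw [smul_eq_mul] at h
  rw [ellipseIntegral, ← h]
  refine circleIntegral.integral_congr hr0.le fun v hv => ?_
  simpa using hfg v (by simpa using hv)

lemma ellipseIntegral_inv_sub {r : ℝ} (hr0 : 0 < r) (hr : r < 1) {x : ℝ} (hx : |x| ≤ 1) :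
    ellipseIntegral r (fun z => (z - x)⁻¹) = -(2 * Real.pi * Complex.I) := by
  rw [ellipseIntegral_of_eq_inv_mul hr0 hr
    (g := fun v => (v ^ 2 - 1) * (v ^ 2 - 2 * x * v + 1)⁻¹)]
  · simp
  · intro v hv
    have := sq_sub_two_mul_add_one_ne_zero hx hv
    fun_prop (disch := assumption)
  · intro v hv
    have h0 : v ≠ 0 := by rintro rfl; simp at hv; linarith
    rw [joukowski_sub_inv h0]
    generalize (v ^ 2 - 2 * x * v + 1)⁻¹ = y
    field_simp

lemma ellipseIntegral_inv_sub_mul_inv_sub {r : ℝ} (hr0 : 0 < r) (hr : r < 1) {x y : ℝ}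
    (hx : |x| ≤ 1) (hy : |y| ≤ 1) :
    ellipseIntegral r (fun z => (z - x)⁻¹ * (z - y)⁻¹) = 0 := by
  rw [ellipseIntegral_of_eq_inv_mul hr0 hr
    (g := fun v => 2 * v * (v ^ 2 - 1) * (v ^ 2 - 2 * x * v + 1)⁻¹ * (v ^ 2 - 2 * y * v + 1)⁻¹)]
  · simp
  · intro v hv
    have := sq_sub_two_mul_add_one_ne_zero hx hv
    have := sq_sub_two_mul_add_one_ne_zero hy hv
    fun_prop (disch := assumption)
  · intro v hv
    have h0 : v ≠ 0 := by rintro rfl; simp at hv; linarith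
    rw [joukowski_sub_inv h0, joukowski_sub_inv h0]
    generalize (v ^ 2 - 2 * x * v + 1)⁻¹ = a
    generalize (v ^ 2 - 2 * y * v + 1)⁻¹ = b
    field_simp

lemma norm_sq_circleMap_sub_inv {r : ℝ} (hr0 : 0 < r) (θ : ℝ) :
    ‖circleMap 0 r θ - (circleMap 0 r θ)⁻¹‖ ^ 2 = r ^ 2 + (r ^ 2)⁻¹ + 2 - 4 * Real.cos θ ^ 2 := by
  have e : circleMap 0 r θ - (circleMap 0 r θ)⁻¹ =
      ((r - r⁻¹) * Real.cos θ : ℝ) + ((r + r⁻¹) * Real.sin θ : ℝ) * Complex.I := by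
    simp only [circleMap, zero_add]
    rw [mul_inv, ← Complex.exp_neg, ← neg_mul, Complex.exp_mul_I, Complex.exp_mul_I,
      Complex.cos_neg, Complex.sin_neg]
    push_cast
    ring
  rw [e, Complex.sq_norm, Complex.normSq_add_mul_I]
  have := Real.sin_sq_add_cos_sq θ
  have hs : Real.sin θ ^ 2 = 1 - Real.cos θ ^ 2 := by linarith
  rw [mul_pow, mul_pow, hs]
  field_simp
  ring

lemma norm_ellipseIntegral_le {r : ℝ} (hr0 : 0 < r) {f : ℂ → ℂ} {B : ℝ} (_hB : 0 ≤ B)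
    (hf : ∀ v : ℂ, ‖v‖ = r → ‖f ((v + v⁻¹) / 2)‖ ≤ B) :
    ‖ellipseIntegral r f‖ ≤ Real.pi * Real.sqrt (r ^ 2 + (r ^ 2)⁻¹) * B := by
  obtain ⟨S, hS⟩ : ∃ S, S = r ^ 2 + (r ^ 2)⁻¹ := ⟨_, rfl⟩
  rw [← hS]
  have hS0 : 0 < S := by rw [hS]; positivity
  set s := Real.sqrt S with hs
  have hs0 : 0 < s := Real.sqrt_pos.mpr hS0
  have hss : s ^ 2 = S := Real.sq_sqrt hS0.le
  -- s is the root mean square of |v - v⁻¹| over the circle, so the integrated AM–GM majorant has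
  -- exactly the Cauchy–Schwarz value.
  have hint : ∫ θ in (0 : ℝ)..2 * Real.pi,
      B * ((S + 2 - 4 * Real.cos θ ^ 2) / s + s) / 4 = Real.pi * s * B := by
    have e : ∀ θ : ℝ, B * ((S + 2 - 4 * Real.cos θ ^ 2) / s + s) / 4 =
        B * ((S + 2) / s + s) / 4 - B / s * Real.cos θ ^ 2 := fun θ => by field_simp; ring
    simp only [e]
    rw [intervalIntegral.integral_sub (by simp)
      ((by fun_prop : Continuous fun θ : ℝ => B / s * Real.cos θ ^ 2).intervalIntegrable _ _),
      intervalIntegral.integral_const, intervalIntegral.integral_const_mul, integral_cos_sq]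
    simp only [Real.sin_two_pi, Real.sin_zero, smul_eq_mul]
    field_simp
    rw [← hss]
    ring
  rw [← hint, ellipseIntegral, circleIntegral]
  refine intervalIntegral.norm_integral_le_of_norm_le Real.two_pi_pos.le
    (Eventually.of_forall fun θ _ => ?_)
    ((by fun_prop : Continuous fun θ : ℝ =>
      B * ((S + 2 - 4 * Real.cos θ ^ 2) / s + s) / 4).intervalIntegrable _ _)
  have hv : ‖circleMap 0 r θ‖ = r := by simp [abs_of_pos hr0]
  have h0 : circleMap 0 r θ ≠ 0 := circleMap_ne_center hr0.ne'
  have hsq := norm_sq_circleMap_sub_inv hr0 θ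
  rw [← hS] at hsq
  have hfv := hf _ hv
  rw [deriv_circleMap, smul_eq_mul]
  have e : circleMap 0 r θ * Complex.I * ((1 - (circleMap 0 r θ ^ 2)⁻¹) / 2 *
      f ((circleMap 0 r θ + (circleMap 0 r θ)⁻¹) / 2)) =
      Complex.I * ((circleMap 0 r θ - (circleMap 0 r θ)⁻¹) / 2) *
        f ((circleMap 0 r θ + (circleMap 0 r θ)⁻¹) / 2) := by
    generalize f _ = y
    field_simp
  rw [e, norm_mul, norm_mul, Complex.norm_I, one_mul, norm_div, Complex.norm_two, ← hsq]
  set a := ‖circleMap 0 r θ - (circleMap 0 r θ)⁻¹‖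
  have ha : 0 ≤ a := norm_nonneg _
  have h2 : a ≤ (a ^ 2 / s + s) / 2 := by
    rw [le_div_iff₀ two_pos, div_add' _ _ _ hs0.ne', le_div_iff₀ hs0]
    nlinarith [sq_nonneg (a - s)]
  calc a / 2 * ‖f ((circleMap 0 r θ + (circleMap 0 r θ)⁻¹) / 2)‖
      ≤ (a ^ 2 / s + s) / 2 / 2 * B := by gcongr
    _ = _ := by ring

end Ellipse

/-! ### Hermite's remainder and the differentiation error. -/

section Interpolation

lemma AnalyticAt.dslope {f : ℂ → ℂ} {a z : ℂ} (ha : AnalyticAt ℂ f a) (hz : AnalyticAt ℂ f z) :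
    AnalyticAt ℂ (dslope f a) z := by
  rcases eq_or_ne z a with rfl | hne
  · obtain ⟨p, hp⟩ := ha
    exact hp.has_fpower_series_dslope_fslope.analyticAt
  · refine AnalyticAt.congr ?_ (dslope_eventuallyEq_slope_of_ne f hne).symm
    have : AnalyticAt ℂ (fun y => (y - a)⁻¹ • (f y - f a)) z :=
      ((analyticAt_id.sub analyticAt_const).inv (sub_ne_zero.mpr hne)).smul
        (hz.sub analyticAt_const)
    exact this

/-- The zeros are divided out one at a time; `dslope` removes each singularity. -/
lemma exists_analyticOnNhd_eq_prod_mul {S : Set ℂ} (s : Finset ℝ) (hs : ∀ x ∈ s, (x : ℂ) ∈ S)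
    {f : ℂ → ℂ} (hf : AnalyticOnNhd ℂ f S) (h0 : ∀ x ∈ s, f (x : ℂ) = 0) :
    ∃ q : ℂ → ℂ, AnalyticOnNhd ℂ q S ∧ ∀ z, f z = (∏ x ∈ s, (z - (x : ℂ))) * q z := by
  induction s using Finset.induction_on generalizing f with
  | empty => exact ⟨f, hf, fun z => by simp⟩
  | insert a s has ih =>
    have haS := hs a (Finset.mem_insert_self _ _)
    have hfa := h0 a (Finset.mem_insert_self _ _)
    have hmul : ∀ z, f z = (z - a) * dslope f a z := fun z => by
      rw [← smul_eq_mul, sub_smul_dslope, hfa, sub_zero]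
    obtain ⟨q, hq, hfq⟩ := ih (fun x hx => hs x (Finset.mem_insert_of_mem hx))
      (f := dslope f a) (fun z hz => (hf a haS).dslope (hf z hz)) (fun x hx => by
        have h := hmul x
        rw [h0 x (Finset.mem_insert_of_mem hx)] at h
        have hxa : x ≠ a := fun h => has (h ▸ hx)
        exact (mul_eq_zero.mp h.symm).resolve_left
          (sub_ne_zero.mpr (Complex.ofReal_injective.ne hxa)))
    refine ⟨q, hq, fun z => ?_⟩
    rw [hmul, hfq, Finset.prod_insert has, mul_assoc]

lemma circleIntegrable_ellipse {r : ℝ} (hr0 : 0 < r) {f : ℂ → ℂ}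
    (hf : ∀ v : ℂ, ‖v‖ = r → ContinuousAt f ((v + v⁻¹) / 2)) :
    CircleIntegrable (fun v => (1 - (v ^ 2)⁻¹) / 2 * f ((v + v⁻¹) / 2)) 0 r := by
  refine ContinuousOn.circleIntegrable hr0.le fun v hv => ContinuousAt.continuousWithinAt ?_
  have hv' : ‖v‖ = r := by simpa using hv
  have h0 : v ≠ 0 := by rintro rfl; simp at hv'; linarith
  have h02 : v ^ 2 ≠ 0 := pow_ne_zero 2 h0
  refine ContinuousAt.mul (by fun_prop (disch := assumption)) ?_
  exact ContinuousAt.comp (f := fun v : ℂ => (v + v⁻¹) / 2) (hf v hv')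
    (by fun_prop (disch := assumption))

/-- Hermite's formula at a node, over the ellipse. -/
lemma ellipseIntegral_div_prod {rho : ℝ} (hrho : 1 < rho) (s : Finset ℝ)
    (hs : ∀ x ∈ s, |x| ≤ 1) {u q : ℂ → ℂ} (hq : AnalyticOnNhd ℂ q (bernsteinRegion rho))
    (hu : ∀ z, u z - (Lagrange.interpolate s (fun x : ℝ => (x : ℂ)) (fun x : ℝ => u x)).eval z
      = (∏ x ∈ s, (z - (x : ℂ))) * q z) {y : ℝ} (hy : |y| ≤ 1) :
    ellipseIntegral rho⁻¹ (fun z => u z / ((∏ x ∈ s, (z - (x : ℂ))) * (z - y))) =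
      -(2 * Real.pi * Complex.I) * q y := by
  have hr1 : rho⁻¹ < 1 := inv_lt_one_of_one_lt₀ hrho
  have hr0 : 0 < rho⁻¹ := inv_pos.mpr (by linarith)
  have hne : ∀ v : ℂ, ‖v‖ = rho⁻¹ → ∀ x : ℝ, |x| ≤ 1 → (v + v⁻¹) / 2 - (x : ℂ) ≠ 0 := by
    intro v hv x hx
    have := sub_pos.mpr hr1
    exact norm_pos_iff.mp (lt_of_lt_of_le (by positivity) (le_norm_joukowski_sub hr0 hr1 hv hx))
  have hyS := ofReal_mem_bernsteinRegion hrho hy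
  have hds : AnalyticOnNhd ℂ (dslope q y) (bernsteinRegion rho) := fun z hz =>
    (hq _ hyS).dslope (hq z hz)
  set w : ℝ → ℂ := fun x => Lagrange.nodalWeight s (fun x : ℝ => (x : ℂ)) x * u x with hw
  -- With P the nodal product, the barycentric form of the interpolant gives u/(P(z-y)) = Σ
  -- w_x/((z-x)(z-y)) + (q(z)-q(y))/(z-y) + q(y)/(z-y). The first two parts integrate to zero, even
  -- when x = y; the last yields -2πi q(y).
  have hdecomp : ∀ v : ℂ, ‖v‖ = rho⁻¹ →
      (1 - (v ^ 2)⁻¹) / 2 * (u ((v + v⁻¹) / 2) /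
        ((∏ x ∈ s, ((v + v⁻¹) / 2 - (x : ℂ))) * ((v + v⁻¹) / 2 - y))) =
      (∑ x ∈ s, w x * ((1 - (v ^ 2)⁻¹) / 2 *
        (((v + v⁻¹) / 2 - (x : ℂ))⁻¹ * ((v + v⁻¹) / 2 - (y : ℂ))⁻¹))) +
      ((1 - (v ^ 2)⁻¹) / 2 * dslope q y ((v + v⁻¹) / 2) +
      q y * ((1 - (v ^ 2)⁻¹) / 2 * ((v + v⁻¹) / 2 - (y : ℂ))⁻¹)) := by
    intro v hv
    have hz := hne v hv
    generalize (v + v⁻¹) / 2 = z at *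
    generalize (1 - (v ^ 2)⁻¹) / 2 = d
    have hP : ∏ x ∈ s, (z - (x : ℂ)) ≠ 0 := Finset.prod_ne_zero_iff.mpr fun x hx => hz x (hs x hx)
    have hI := Lagrange.eval_interpolate_not_at_node (s := s) (v := fun x : ℝ => (x : ℂ))
      (fun x : ℝ => u x) (x := z) (fun x hx => sub_ne_zero.mp (hz x (hs x hx)))
    rw [Lagrange.eval_nodal] at hI
    have hqz : q z = (z - y) * dslope q y z + q y := by
      rw [← smul_eq_mul, sub_smul_dslope, sub_add_cancel]
    have huz := hu z
    rw [hI] at huz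
    have hsum : ∑ x ∈ s, w x * (d * ((z - (x : ℂ))⁻¹ * (z - (y : ℂ))⁻¹)) =
        d * (z - (y : ℂ))⁻¹ * ∑ x ∈ s, Lagrange.nodalWeight s (fun x : ℝ => (x : ℂ)) x *
          (z - (x : ℂ))⁻¹ * u x := by
      rw [Finset.mul_sum]
      exact Finset.sum_congr rfl fun x _ => by rw [hw]; ring
    rw [hsum, eq_add_of_sub_eq huz, hqz]
    have hzy := hz y hy
    generalize (∑ x ∈ s, Lagrange.nodalWeight s (fun x : ℝ => (x : ℂ)) x *
      (z - (x : ℂ))⁻¹ * u x) = T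
    field_simp
    ring
  have hcont : ∀ x : ℝ, |x| ≤ 1 → ∀ v : ℂ, ‖v‖ = rho⁻¹ →
      ContinuousAt (fun z : ℂ => (z - (x : ℂ))⁻¹) ((v + v⁻¹) / 2) := fun x hx v hv =>
    (continuousAt_id.sub continuousAt_const).inv₀ (hne v hv x hx)
  have hint1 : ∀ x ∈ s, CircleIntegrable (fun v : ℂ => w x * ((1 - (v ^ 2)⁻¹) / 2 *
        (((v + v⁻¹) / 2 - (x : ℂ))⁻¹ * ((v + v⁻¹) / 2 - (y : ℂ))⁻¹))) 0 rho⁻¹ := fun x hx =>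
    (circleIntegrable_ellipse hr0 (f := fun z => (z - (x : ℂ))⁻¹ * (z - (y : ℂ))⁻¹)
      fun v hv => (hcont x (hs x hx) v hv).mul (hcont y hy v hv)).const_smul (a := w x)
  have hint2 := circleIntegrable_ellipse hr0 (f := dslope q y) fun v hv =>
    (hds _ (joukowski_mem_bernsteinRegion hrho hv.ge (hv ▸ hr1.le))).continuousAt
  have hint3 : CircleIntegrable (fun v : ℂ => q y * ((1 - (v ^ 2)⁻¹) / 2 *
      ((v + v⁻¹) / 2 - (y : ℂ))⁻¹)) 0 rho⁻¹ :=
    (circleIntegrable_ellipse hr0 (f := fun z => (z - (y : ℂ))⁻¹) (hcont y hy)).const_smul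
      (a := q y)
  have hint23 : CircleIntegrable (fun v : ℂ => (1 - (v ^ 2)⁻¹) / 2 * dslope q y ((v + v⁻¹) / 2) +
      q y * ((1 - (v ^ 2)⁻¹) / 2 * ((v + v⁻¹) / 2 - (y : ℂ))⁻¹)) 0 rho⁻¹ := hint2.add hint3
  have hi1 : ∀ x ∈ s, circleIntegral (fun v : ℂ => w x * ((1 - (v ^ 2)⁻¹) / 2 *
        (((v + v⁻¹) / 2 - (x : ℂ))⁻¹ * ((v + v⁻¹) / 2 - (y : ℂ))⁻¹))) 0 rho⁻¹ = 0 := by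
    intro x hx
    rw [circleIntegral.integral_const_mul]
    have h := ellipseIntegral_inv_sub_mul_inv_sub hr0 hr1 (hs x hx) hy
    rw [ellipseIntegral] at h
    rw [h, mul_zero]
  have hi2 := ellipseIntegral_eq_zero hrho hds
  have hi3 := ellipseIntegral_inv_sub hr0 hr1 hy
  rw [ellipseIntegral] at hi2 hi3 ⊢
  rw [circleIntegral.integral_congr hr0.le (fun v hv => hdecomp v (by simpa using hv)),
    circleIntegral.integral_add (CircleIntegrable.fun_sum s hint1) hint23,
    circleIntegral.integral_add hint2 hint3, circleIntegral.integral_fun_sum hint1,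
    Finset.sum_eq_zero hi1, hi2, circleIntegral.integral_const_mul, hi3]
  ring

/-- The error of spectral differentiation at the zeros of `p`. -/
lemma norm_deriv_sub_interpolate_le {rho : ℝ} (hrho : 1 < rho) (s : Finset ℝ)
    (hs : ∀ x ∈ s, |x| ≤ 1) {p : ℝ[X]} {c : ℝ} (hc : c ≠ 0) (hp : p = C c * ∏ x ∈ s, (X - C x))
    {u : ℂ → ℂ} (hu : AnalyticOnNhd ℂ u (bernsteinRegion rho)) {B : ℝ} (hB0 : 0 ≤ B)
    (hB : ∀ v : ℂ, ‖v‖ = rho⁻¹ →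
      ‖u ((v + v⁻¹) / 2)‖ ≤ B * ‖aeval ((v + v⁻¹) / 2) p‖) {y : ℝ} (hy : y ∈ s) :
    ‖deriv (fun z : ℂ => u z -
      (Lagrange.interpolate s (fun x : ℝ => (x : ℂ)) (fun x : ℝ => u x)).eval z) y‖ ≤
      |(derivative p).eval y| * (B * (rho / (rho - 1) ^ 2) *
        Real.sqrt (rho ^ 2 + (rho ^ 2)⁻¹)) := by
  have hrho0 : 0 < rho := by linarith
  have hr1 : rho⁻¹ < 1 := inv_lt_one_of_one_lt₀ hrho
  have hr0 : 0 < rho⁻¹ := inv_pos.mpr hrho0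
  have hcC : (c : ℂ) ≠ 0 := Complex.ofReal_ne_zero.mpr hc
  have haev : ∀ z : ℂ, aeval z p = c * ∏ x ∈ s, (z - (x : ℂ)) := fun z => by
    rw [hp, map_mul, map_prod]
    simp
  obtain ⟨q, hq, hfq⟩ := exists_analyticOnNhd_eq_prod_mul s
    (fun x hx => ofReal_mem_bernsteinRegion hrho (hs x hx))
    (f := fun z : ℂ => u z -
      (Lagrange.interpolate s (fun x : ℝ => (x : ℂ)) (fun x : ℝ => u x)).eval z)
    (hu.sub fun z _ => (Polynomial.differentiable _).analyticAt z)
    (fun x hx => by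
      rw [Lagrange.eval_interpolate_at_node (v := fun x : ℝ => (x : ℂ)) (fun x : ℝ => u x)
        Complex.ofReal_injective.injOn hx, sub_self])
  have hint := ellipseIntegral_div_prod hrho s hs hq hfq (hs y hy)
  -- |c| B bounds u over the nodal product, and 2ρ/(ρ-1)² bounds 1/|z - y|.
  have hbound := norm_ellipseIntegral_le hr0
    (f := fun z => u z / ((∏ x ∈ s, (z - (x : ℂ))) * (z - y)))
    (B := |c| * B * (2 * rho / (rho - 1) ^ 2)) (by positivity) (fun v hv => by
      have hd := le_norm_joukowski_sub hr0 hr1 hv (hs y hy)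
      have hBv := hB v hv
      have hdpos : 0 < (rho - 1) ^ 2 / (2 * rho) := by
        have := sub_pos.mpr hrho
        positivity
      have e : (1 - rho⁻¹) ^ 2 / (2 * rho⁻¹) = (rho - 1) ^ 2 / (2 * rho) := by field_simp
      rw [e] at hd
      have hP : ∏ x ∈ s, ((v + v⁻¹) / 2 - (x : ℂ)) ≠ 0 := by
        refine Finset.prod_ne_zero_iff.mpr fun x hx => norm_pos_iff.mp (lt_of_lt_of_le ?_
          (le_norm_joukowski_sub hr0 hr1 hv (hs x hx)))
        rw [e]; exact hdpos
      rw [haev, norm_mul, Complex.norm_real, Real.norm_eq_abs] at hBv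
      have hPpos := norm_pos_iff.mpr hP
      rw [norm_div, norm_mul, div_le_iff₀ (mul_pos hPpos (hdpos.trans_le hd))]
      refine hBv.trans ?_
      have h1 : 1 ≤ 2 * rho / (rho - 1) ^ 2 * ‖(v + v⁻¹) / 2 - (y : ℂ)‖ := by
        rw [← inv_div, inv_mul_eq_div, le_div_iff₀ hdpos, one_mul]
        exact hd
      have h2 := mul_le_mul_of_nonneg_left h1
        (by positivity : 0 ≤ |c| * B * ‖∏ x ∈ s, ((v + v⁻¹) / 2 - (x : ℂ))‖)
      calc _ = |c| * B * ‖∏ x ∈ s, ((v + v⁻¹) / 2 - (x : ℂ))‖ * 1 := by ring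
        _ ≤ _ := h2
        _ = _ := by ring)
  rw [hint, norm_mul, norm_neg] at hbound
  have hpi : ‖(2 * Real.pi * Complex.I : ℂ)‖ = 2 * Real.pi := by
    simp [abs_of_pos Real.pi_pos]
  have hsq : rho⁻¹ ^ 2 + (rho⁻¹ ^ 2)⁻¹ = rho ^ 2 + (rho ^ 2)⁻¹ := by
    rw [inv_pow, inv_inv, add_comm]
  rw [hpi, hsq] at hbound
  have hqy : ‖q y‖ ≤ |c| * (B * (rho / (rho - 1) ^ 2) * Real.sqrt (rho ^ 2 + (rho ^ 2)⁻¹)) := by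
    refine le_of_mul_le_mul_left (hbound.trans (le_of_eq ?_)) Real.two_pi_pos
    ring
  have hfun : (fun z : ℂ => u z -
      (Lagrange.interpolate s (fun x : ℝ => (x : ℂ)) (fun x : ℝ => u x)).eval z) =
      fun z => (c : ℂ)⁻¹ * (aeval z p * q z) := by
    funext z
    rw [hfq z, haev, mul_assoc, inv_mul_cancel_left₀ hcC]
  have hqd := (hq _ (ofReal_mem_bernsteinRegion hrho (hs y hy))).differentiableAt.hasDerivAt
  -- p(y) = 0 removes p q' from the product rule, so no bound on q' is needed.
  have hpy : aeval (y : ℂ) p = 0 := by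
    rw [haev, Finset.prod_eq_zero hy (sub_self (y : ℂ)), mul_zero]
  have hder := ((p.hasDerivAt_aeval (y : ℂ)).mul hqd).const_mul (c : ℂ)⁻¹
  rw [hpy, zero_mul, add_zero, show (y : ℂ) = algebraMap ℝ ℂ y from rfl,
    aeval_algebraMap_apply] at hder
  rw [hfun]
  have hder' := hder.deriv
  simp only [Complex.coe_algebraMap, coe_aeval_eq_eval, Pi.mul_apply] at hder'
  rw [show deriv (fun z => (c : ℂ)⁻¹ * (aeval z p * q z)) (y : ℂ) = _ from hder',
    norm_mul, norm_mul, norm_inv, Complex.norm_real, Complex.norm_real, Real.norm_eq_abs,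
    Real.norm_eq_abs]
  have hcpos := abs_pos.mpr hc
  calc |c|⁻¹ * (|(derivative p).eval y| * ‖q y‖)
      ≤ |c|⁻¹ * (|(derivative p).eval y| * (|c| * (B * (rho / (rho - 1) ^ 2) *
        Real.sqrt (rho ^ 2 + (rho ^ 2)⁻¹)))) := by gcongr
    _ = _ := by
      rw [mul_left_comm, inv_mul_cancel_left₀ hcpos.ne']

end Interpolation

/-! ### The constants c_n and their limit. -/

section ErrorConstant

variable {lam : ℝ}

lemma norm_le_ellipseMax {rho : ℝ} (hrho : 1 < rho) {u : ℂ → ℂ}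
    (hu : AnalyticOnNhd ℂ u (bernsteinRegion rho)) {v : ℂ} (hv : ‖v‖ = rho⁻¹) :
    ‖u ((v + v⁻¹) / 2)‖ ≤ ellipseMax rho u := by
  have hrho0 : 0 < rho := by linarith
  have hr1 : rho⁻¹ < 1 := inv_lt_one_of_one_lt₀ hrho
  have himage : (fun z : ℂ => ‖u z‖) '' bernsteinEllipse rho =
      (fun v : ℂ => ‖u ((v + v⁻¹) / 2)‖) '' Metric.sphere 0 rho⁻¹ := by
    ext t
    constructor
    · rintro ⟨_, ⟨w, hw, rfl⟩, rfl⟩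
      exact ⟨w⁻¹, by simp [hw], by simp [add_comm]⟩
    · rintro ⟨w, hw, rfl⟩
      exact ⟨_, ⟨w⁻¹, by rw [norm_inv, mem_sphere_zero_iff_norm.mp hw, inv_inv], rfl⟩,
        by simp [add_comm]⟩
  rw [ellipseMax, himage]
  -- Boundedness by compactness is what makes the supremum `ellipseMax` a genuine bound.
  refine le_csSup ?_ ⟨v, by simpa using hv, rfl⟩
  refine ((isCompact_sphere (0 : ℂ) rho⁻¹).image_of_continuousOn fun w hw => ?_).bddAbove
  have hw' := mem_sphere_zero_iff_norm.mp hw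
  have h0 : w ≠ 0 := norm_pos_iff.mp (by rw [hw']; positivity)
  have hc := (hu _ (joukowski_mem_bernsteinRegion hrho hw'.ge (hw' ▸ hr1.le))).continuousAt
  exact (ContinuousAt.comp (f := fun v : ℂ => (v + v⁻¹) / 2) hc
    (by fun_prop (disch := assumption))).norm.continuousWithinAt

/-- The sequence `c_n` attached to lower bounds `m n` of the normalized Gegenbauer polynomials. -/
noncomputable def errorRatio (lam rho : ℝ) (m : ℕ → ℝ) (n : ℕ) : ℝ :=
  -- At n = 0 the factor 0^{λ+2} = 0 would make the quotient 0, so positivity needs a separate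
  -- value.
  if n = 0 then 1 else
    |lam| * risingCoeff (2 * (lam + 1)) n * Real.Gamma (2 * lam + 2) /
      (m n * |risingCoeff lam (n + 1)| * Real.Gamma (lam + 1) * ellipseFactor lam rho *
        (n : ℝ) ^ (lam + 2))

lemma errorRatio_pos (hlam : -(1 / 2 : ℝ) < lam) (hlam0 : lam ≠ 0) {rho : ℝ} (hrho : 1 < rho)
    {m : ℕ → ℝ} (hm : ∀ n, 0 < m n) (n : ℕ) : 0 < errorRatio lam rho m n := by
  unfold errorRatio
  split_ifs with h
  · exact one_pos
  · have h1 : 0 < (n : ℝ) ^ (lam + 2) :=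
      Real.rpow_pos_of_pos (by exact_mod_cast Nat.pos_of_ne_zero h) _
    have h2 := risingCoeff_pos (by linarith : 0 < 2 * (lam + 1)) n
    have h3 := Real.Gamma_pos_of_pos (by linarith : 0 < 2 * lam + 2)
    have h4 := Real.Gamma_pos_of_pos (by linarith : 0 < lam + 1)
    have h5 := ellipseFactor_pos (lam := lam) hrho
    have h6 := abs_pos.mpr (risingCoeff_ne_zero hlam hlam0 (n + 1))
    have h7 := abs_pos.mpr hlam0
    have h8 := hm n
    positivity

lemma tendsto_errorRatio (hlam : -(1 / 2 : ℝ) < lam) (hlam0 : lam ≠ 0) {rho : ℝ} (hrho : 1 < rho)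
    {m : ℕ → ℝ} (hm0 : ∀ n, 0 < m n) (hm : Tendsto m atTop (𝓝 (ellipseFactor lam rho)⁻¹)) :
    Tendsto (errorRatio lam rho m) atTop (𝓝 1) := by
  have hK := ellipseFactor_pos (lam := lam) hrho
  have hΓ2 := Real.Gamma_pos_of_pos (by linarith : 0 < 2 * (lam + 1))
  have hΓ1 := Real.Gamma_pos_of_pos (by linarith : 0 < lam + 1)
  have hlm : ∀ k : ℕ, lam ≠ -k := by
    rintro (_ | k) h
    · simp at h; exact hlam0 h
    · push_cast at h
      have : (0 : ℝ) ≤ k := by positivity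
      linarith
  have hΓ := Real.Gamma_ne_zero hlm
  have hG := tendsto_risingCoeff_div_rpow (s := 2 * (lam + 1)) (fun k h => by
    have : (0 : ℝ) ≤ k := by positivity
    linarith)
  have hA := (tendsto_risingCoeff_div_rpow hlm).abs.inv₀ (abs_ne_zero.mpr (inv_ne_zero hΓ))
  have hS := (tendsto_risingCoeff_shift hlam hlam0 1).abs
  have hM := hm.inv₀ (inv_ne_zero hK.ne')
  have h := (((hG.mul hA).mul hS).mul hM).const_mul
    (|lam| * Real.Gamma (2 * (lam + 1)) / (Real.Gamma (lam + 1) * ellipseFactor lam rho))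
  have hlim : |lam| * Real.Gamma (2 * (lam + 1)) / (Real.Gamma (lam + 1) * ellipseFactor lam rho) *
      ((Real.Gamma (2 * (lam + 1)))⁻¹ * |(Real.Gamma lam)⁻¹|⁻¹ * |1| *
        (ellipseFactor lam rho)⁻¹⁻¹) = 1 := by
    -- Γ(λ) < 0 when -1/2 < λ < 0; absolute values make Γ(λ+1) = λΓ(λ) usable for both signs.
    have e : |lam| * |Real.Gamma lam| = Real.Gamma (lam + 1) := by
      rw [← abs_mul, ← Real.Gamma_add_one hlam0, abs_of_pos hΓ1]
    rw [abs_inv, inv_inv, inv_inv, abs_one, ← e]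
    have := abs_pos.mpr hΓ
    have := abs_pos.mpr hlam0
    field_simp
  rw [hlim] at h
  refine h.congr' ?_
  filter_upwards [eventually_gt_atTop 0] with n hn
  have hn' : (0 : ℝ) < n := by exact_mod_cast hn
  have h1 := Real.rpow_pos_of_pos hn' (lam - 1)
  have h2 := Real.rpow_pos_of_pos hn' (lam + 2)
  have hpow : (n : ℝ) ^ (2 * (lam + 1) - 1) = (n : ℝ) ^ (lam - 1) * (n : ℝ) ^ (lam + 2) := by
    rw [← Real.rpow_add hn']; congr 1; ring
  have h3 := abs_pos.mpr (risingCoeff_ne_zero hlam hlam0 (n + 1))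
  have h4 := abs_pos.mpr (risingCoeff_ne_zero hlam hlam0 n)
  have h5 := hm0 n
  rw [errorRatio, if_neg hn.ne', hpow, abs_div, abs_div, abs_of_pos h1,
    show 2 * lam + 2 = 2 * (lam + 1) by ring]
  field_simp

lemma abs_eval_derivative_gegenbauer_le (hlam : -(1 / 2 : ℝ) < lam) (n : ℕ) {x : ℝ}
    (hx : |x| ≤ 1) : |(derivative (gegenbauer lam (n + 1))).eval x| ≤
      2 * |lam| * risingCoeff (2 * (lam + 1)) n := by
  rw [derivative_gegenbauer_succ, eval_mul, eval_C, abs_mul, abs_mul, abs_two]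
  exact mul_le_mul_of_nonneg_left (abs_eval_gegenbauer_le (by linarith) n hx) (by positivity)

end ErrorConstant

theorem theorem4p2 (lam : ℝ) (hlam : -(1 / 2 : ℝ) < lam) (hlam0 : lam ≠ 0)
    (rho : ℝ) (hrho : 1 < rho) :
    (∀ n : ℕ, (gegenbauerGauss lam n).card = n + 1) ∧
    ∃ c : ℕ → ℝ, (∀ n, 0 < c n) ∧ Tendsto c atTop (𝓝 1) ∧
      ∀ u : ℂ → ℂ, AnalyticOnNhd ℂ u (bernsteinRegion rho) →
        ∀ n : ℕ, 1 ≤ n → ∀ x ∈ gegenbauerGauss lam n,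
          ‖deriv (fun z : ℂ => u z - (gegenbauerInterp lam n u).eval z) (x : ℂ)‖
            ≤ spectralDiffConst (c n) (ellipseMax rho u) rho lam
                * ((n : ℝ) ^ (lam + 2) / rho ^ n) := by
  refine ⟨card_gegenbauerGauss hlam hlam0, ?_⟩
  obtain ⟨m, hm0, hm, hlow⟩ := exists_lower_bound_gegenbauer hlam hlam0 hrho
  refine ⟨errorRatio lam rho m, errorRatio_pos hlam hlam0 hrho hm0,
    tendsto_errorRatio hlam hlam0 hrho hm0 hm, fun u hu n hn x hx => ?_⟩
  have hrho0 : 0 < rho := by linarith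
  have hM0 : 0 ≤ ellipseMax rho u := Real.sSup_nonneg (by rintro _ ⟨z, _, rfl⟩; positivity)
  have ha := abs_pos.mpr (risingCoeff_ne_zero hlam hlam0 (n + 1))
  have hmn := hm0 n
  have hn' : (0 : ℝ) < n := by exact_mod_cast hn
  have hpow := Real.rpow_pos_of_pos hn' (lam + 2)
  have hΓ2 := Real.Gamma_pos_of_pos (by linarith : 0 < 2 * lam + 2)
  have hΓ1 := Real.Gamma_pos_of_pos (by linarith : 0 < lam + 1)
  have hK := ellipseFactor_pos (lam := lam) hrho
  have hrho1 : 0 < rho - 1 := sub_pos.mpr hrho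
  have hden : 0 < m n * |risingCoeff lam (n + 1)| * rho ^ (n + 1) := by positivity
  have hmain := norm_deriv_sub_interpolate_le hrho (gegenbauerGauss lam n)
    (fun y hy => (abs_lt_one_of_mem_gegenbauerGauss hlam hlam0 hy).le)
    (leadingCoeff_ne_zero.mpr (gegenbauer_ne_zero hlam hlam0 (n + 1)))
    (gegenbauer_eq_C_mul_prod hlam hlam0 n) hu
    (B := ellipseMax rho u / (m n * |risingCoeff lam (n + 1)| * rho ^ (n + 1)))
    (by positivity) (fun v hv => by
      rw [div_mul_eq_mul_div, le_div_iff₀ hden]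
      exact mul_le_mul (norm_le_ellipseMax hrho hu hv) (hlow n v hv) hden.le hM0) hx
  have hder := abs_eval_derivative_gegenbauer_le hlam n
    (abs_lt_one_of_mem_gegenbauerGauss hlam hlam0 hx).le
  refine hmain.trans ((mul_le_mul_of_nonneg_right hder (by positivity)).trans (le_of_eq ?_))
  -- An equality: `errorRatio` is the quotient of the bound obtained by the stated one. One factor
  -- of ρ^{n+1} cancels against the numerator of ρ/(ρ-1)², leaving ρ^n.
  rw [spectralDiffConst, ← ellipseFactor, errorRatio, if_neg (by omega), pow_succ rho n]
  generalize Real.Gamma (2 * lam + 2) = g at *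
  field_simp
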